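/- Let $k_X$ be a continuous covariance kernel on $[0,1]^2$, let $\mathrm{rank}(k_X)\in\{0,1,\dots,\infty\}$ be the rank of its integral operator (the number of terms of its Mercer expansion), and let $d\ge 1$. For $L\ge 1$ call nodes $t_1<\dots<t_L$ regular if $(j-1)/L\le t_j<j/L$ for all $j$. Let $X_1,X_2,\dots$ be i.i.d. zero-mean second-order processes on $[0,1]$ with covariance $k_X$, and let $W_{ij}=X_i(t_j)+\varepsilon_{ij}$, $j\le L$, where the errors $\varepsilon_{ij}$ are independent of each other and of the $X_i$, have mean $0$ and variance $\sigma_j^2\in[0,\infty)$, and have a law that does not depend on $i$. Put $K_{X,L}=\{k_X(t_i,t_j)\}_{i,j}$, $K_{W,L}=K_{X,L}+\mathrm{diag}(\sigma_1^2,\dots,\sigma_L^2)$, $\widehat K_{W,L}=\frac1n\sum_{i=1}^n W_iW_i^\top$ with $W_i=(W_{i1},\dots,W_{iL})^\top$, $P_L=\{\mathbf 1\{i\ne j\}\}_{i,j=1}^L$, and, with $\circ$ the entrywise product and $\|\cdot\|_F$ the Frobenius norm, $$T_q=\inf_{\Theta\in\mathbb R^{L\times L},\ \mathrm{rank}\,\Theta\le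 q}\|P_L\circ(\widehat K_{W,L}-\Theta)\|_F^2,\qquad \Psi(C)=\|P_L\circ(K_{W,L}-CC^\top)\|_F^2\quad(C\in\mathbb R^{L\times q}).$$ There is an integer $L_\dagger\ge d$, depending only on $k_X$ and $d$, such that for all $L>L_\dagger$, all regular nodes and all $1\le q\le d$ the following hold. (0) (Critical grid size.) On the matrices $\Theta\in\mathbb R^{L\times L}$ of rank at most $q$, the functional $\|P_L\circ(K_{W,L}-\Theta)\|_F^2$ vanishes exactly at $K_{X,L}$ if $\mathrm{rank}(k_X)=q$, and is bounded below by a positive constant if $\mathrm{rank}(k_X)>q$. (1) (Limit of the empirical covariance.) If all $X_1(t_j)$ and $\varepsilon_{1j}$ have finite fourth moments, then $\sqrt n(\widehat K_{W,L}-K_{W,L})$ converges in law to a centred Gaussian random matrix. (2) (Null hypothesis $H_{0,q}$.) Suppose that $\mathrm{rank}(k_X)=q$, that $\sqrt n(\widehat K_{W,L}-K_{W,L})$ converges in law to a random matrix $Z$, and that $K_{X,L}=C_0C_0^\top$ with $C_0\in\mathbb R^{L\times q}$. If the Hessian $\nabla^2\Psi(C_0)$ (a $qL\times qL$ matrix in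 the coordinates $\mathrm{vec}\,C$) is nonsingular, then, as $n\to\infty$, $$nT_q\xrightarrow{d}\|P_L\circ Z\|_F^2-8\,\mathrm{vec}(P_L\circ Z)^\top\{(C_0\otimes I_L)\,(\nabla^2\Psi(C_0))^{-1}(C_0^\top\otimes I_L)\}\,\mathrm{vec}(P_L\circ Z).$$ More generally, if $\nabla^2\Psi(C_0)$ is nonsingular up to rotations, i.e. every $S\in\mathbb R^{L\times q}$ with $\nabla^2\Psi(C_0)\,\mathrm{vec}\,S=0$ has the form $S=C_0A$ with $A^\top=-A$, then the same limit holds with $(\nabla^2\Psi(C_0))^{-1}$ replaced by any generalized inverse $G$, i.e. any matrix with $\nabla^2\Psi(C_0)\,G\,\nabla^2\Psi(C_0)=\nabla^2\Psi(C_0)$. (3) (Alternative $H_{1,q}$.) If $\mathrm{rank}(k_X)>q$, then $nT_q\to\infty$ almost surely as $n\to\infty$. -/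

import Mathlib

open MeasureTheory ProbabilityTheory Filter Matrix
open scoped Topology Kronecker unitInterval

noncomputable section

namespace OffDiagRank

/-! ### Matrices -/

/-- The squared Frobenius norm `‖A‖_F² = trace (Aᵀ A)`. -/
def frobSq {m n : ℕ} (A : Matrix (Fin m) (Fin n) ℝ) : ℝ := (Aᵀ * A).trace

/-- The mask `P_L`: zero on the diagonal, one elsewhere. -/
def offDiag (L : ℕ) : Matrix (Fin L) (Fin L) ℝ :=
  Matrix.of fun i j => if i = j then 0 else 1

/-- The off-diagonal discrepancy `Θ ↦ ‖P_L ∘ (K - Θ)‖_F²`. -/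
def offDiagLoss {L : ℕ} (K Θ : Matrix (Fin L) (Fin L) ℝ) : ℝ :=
  frobSq (offDiag L ⊙ (K - Θ))

/-- `Ψ(C) = ‖P_L ∘ (K - C Cᵀ)‖_F²` for `C ∈ ℝ^{L × q}`. -/
def Psi {L q : ℕ} (K : Matrix (Fin L) (Fin L) ℝ) (C : Matrix (Fin L) (Fin q) ℝ) : ℝ :=
  offDiagLoss K (C * Cᵀ)

/-- The Hessian matrix `(∂²f / ∂x_a ∂x_b)` of a function of finitely many real variables. -/
def hessian {ι : Type*} [Fintype ι] [DecidableEq ι] (f : (ι → ℝ) → ℝ) (x : ι → ℝ) :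
    Matrix ι ι ℝ :=
  Matrix.of fun a b => iteratedFDeriv ℝ 2 f x ![Pi.single a 1, Pi.single b 1]

/-- The Hessian `∇²Ψ(C)`, a `qL × qL` matrix in the coordinates `vec C` (columns of `C` stacked:
the coordinate with index `(b, a)` is `C a b`). -/
def hessPsi {L q : ℕ} (K : Matrix (Fin L) (Fin L) ℝ) (C : Matrix (Fin L) (Fin q) ℝ) :
    Matrix (Fin q × Fin L) (Fin q × Fin L) ℝ :=
  hessian (fun x => Psi K (Matrix.of fun a b => x (b, a))) (vec C)

/-- The Hessian of `Ψ` at `C` is nonsingular up to rotations: its null space contains only the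
tangents `C A`, `A` skew-symmetric, to the orbit `{C O : O orthogonal}`, on which `Ψ` is
constant. -/
def HessNonsingularModRotations {L q : ℕ} (K : Matrix (Fin L) (Fin L) ℝ)
    (C : Matrix (Fin L) (Fin q) ℝ) : Prop :=
  ∀ S : Matrix (Fin L) (Fin q) ℝ, hessPsi K C *ᵥ vec S = 0 →
    ∃ A : Matrix (Fin q) (Fin q) ℝ, Aᵀ = -A ∧ S = C * A

/-- The functional
`‖P_L ∘ Z‖_F² - 8 vec(P_L ∘ Z)ᵀ {(C ⊗ I_L) G (Cᵀ ⊗ I_L)} vec(P_L ∘ Z)`. -/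
def limitForm {L q : ℕ} (C : Matrix (Fin L) (Fin q) ℝ)
    (G : Matrix (Fin q × Fin L) (Fin q × Fin L) ℝ) (Z : Matrix (Fin L) (Fin L) ℝ) : ℝ :=
  frobSq (offDiag L ⊙ Z) -
    8 * (vec (offDiag L ⊙ Z) ⬝ᵥ
      (((C ⊗ₖ (1 : Matrix (Fin L) (Fin L) ℝ)) * G * (Cᵀ ⊗ₖ (1 : Matrix (Fin L) (Fin L) ℝ))) *ᵥ
        vec (offDiag L ⊙ Z)))

/-! ### Kernels and grids -/

/-- Covariance kernels on `[0,1]²`: all matrices `(k(u_i, u_j))` are symmetric and positive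
semidefinite. -/
def IsCovarianceKernel (k : I → I → ℝ) : Prop :=
  ∀ (n : ℕ) (u : Fin n → I), (Matrix.of fun i j => k (u i) (u j)).PosSemidef

/-- The range of the integral operator `f ↦ ∫ k(·, t) f(t) dt` on `L²[0,1]`. (For a continuous
kernel this set of functions is already a subspace, and consists of continuous functions.) -/
def kernelRange (k : I → I → ℝ) : Submodule ℝ (I → ℝ) :=
  Submodule.span ℝ {g | ∃ f : I → ℝ, MemLp f 2 ∧ g = fun s => ∫ t, k s t * f t}

/-- The rank of a kernel: the dimension (possibly `∞`) of the range of its integral operator,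
i.e. the number of terms of its Mercer expansion. -/
def kernelRank (k : I → I → ℝ) : ℕ∞ :=
  Cardinal.toENat (Module.rank ℝ (kernelRange k))

/-- Regularly spaced nodes: `(j-1)/L ≤ t_j < j/L` for `j = 1, …, L`
(the index `j : Fin L` starts at `0`). -/
def RegularGrid {L : ℕ} (t : Fin L → I) : Prop :=
  ∀ j : Fin L, ((j : ℕ) : ℝ) / L ≤ (t j : ℝ) ∧ (t j : ℝ) < (((j : ℕ) : ℝ) + 1) / L

/-- `K_{X,L} = (k(t_i, t_j))`. -/
def KX {L : ℕ} (k : I → I → ℝ) (t : Fin L → I) : Matrix (Fin L) (Fin L) ℝ :=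
  Matrix.of fun i j => k (t i) (t j)

/-- `K_{W,L} = K_{X,L} + diag(σ_1², …, σ_L²)`, with `v j = σ_j²`. -/
def KW {L : ℕ} (k : I → I → ℝ) (t : Fin L → I) (v : Fin L → ℝ) : Matrix (Fin L) (Fin L) ℝ :=
  KX k t + Matrix.diagonal v

/-- `L₀` is a critical grid size for the kernel `k` and the bound `d`: on every regular grid of
more than `L₀` points and for every `q ∈ {1, …, d}`, the functional
`Θ ↦ ∑_{i ≠ j} (K_{W,L}(i,j) - Θ(i,j))²` on matrices of rank at most `q` vanishes uniquely at
`K_{X,L}` if `rank k = q`, and is bounded below by a positive constant if `rank k > q`. -/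
def IsCriticalGridSize (k : I → I → ℝ) (d L₀ : ℕ) : Prop :=
  ∀ L : ℕ, L₀ < L → ∀ t : Fin L → I, RegularGrid t → ∀ v : Fin L → ℝ, (∀ j, 0 ≤ v j) →
    ∀ q : ℕ, 1 ≤ q → q ≤ d →
      (kernelRank k = q → (KX k t).rank ≤ q ∧
        ∀ Θ : Matrix (Fin L) (Fin L) ℝ, Θ.rank ≤ q →
          (offDiagLoss (KW k t v) Θ = 0 ↔ Θ = KX k t)) ∧
      ((q : ℕ∞) < kernelRank k → ∃ c : ℝ, 0 < c ∧
        ∀ Θ : Matrix (Fin L) (Fin L) ℝ, Θ.rank ≤ q → c ≤ offDiagLoss (KW k t v) Θ)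

/-! ### Noisy discrete measurements -/

/-- `X 0, X 1, …` are i.i.d. replications of a zero-mean second-order process on `[0,1]` with
covariance kernel `k`; the errors `ε i j` are independent of the replications and of each other,
centred, with variance `v j = σ_j²` and with a law that does not depend on `i`. -/
structure NoisySample {Ω : Type*} [MeasurableSpace Ω] (P : Measure Ω) {L : ℕ} (k : I → I → ℝ)
    (v : Fin L → ℝ) (X : ℕ → I → Ω → ℝ) (ε : ℕ → Fin L → Ω → ℝ) : Prop where
  measurable_X : ∀ i s, Measurable (X i s)
  indep_X : iIndepFun (fun i ω (s : I) => X i s ω) P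
  ident_X : ∀ i, IdentDistrib (fun ω (s : I) => X i s ω) (fun ω (s : I) => X 0 s ω) P P
  memLp_X : ∀ s, MemLp (X 0 s) 2 P
  mean_X : ∀ s, ∫ ω, X 0 s ω ∂P = 0
  cov_X : ∀ s s', ∫ ω, X 0 s ω * X 0 s' ω ∂P = k s s'
  measurable_eps : ∀ i j, Measurable (ε i j)
  indep_eps : iIndepFun (fun p : ℕ × Fin L => ε p.1 p.2) P
  ident_eps : ∀ i j, IdentDistrib (ε i j) (ε 0 j) P P
  memLp_eps : ∀ j, MemLp (ε 0 j) 2 P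
  mean_eps : ∀ j, ∫ ω, ε 0 j ω ∂P = 0
  var_eps : ∀ j, ∫ ω, ε 0 j ω ^ 2 ∂P = v j
  indep_X_eps : IndepFun (fun ω (p : ℕ × I) => X p.1 p.2 ω)
    (fun ω (p : ℕ × Fin L) => ε p.1 p.2 ω) P

/-- The measurements `W_{ij} = X_i(t_j) + ε_{ij}`. -/
def measurement {Ω : Type*} {L : ℕ} (t : Fin L → I) (X : ℕ → I → Ω → ℝ)
    (ε : ℕ → Fin L → Ω → ℝ) (i : ℕ) (ω : Ω) : Fin L → ℝ :=
  fun j => X i (t j) ω + ε i j ω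

/-- The empirical covariance `n⁻¹ ∑_{i < n} W_i W_iᵀ`. -/
def empCov {Ω : Type*} {L : ℕ} (W : ℕ → Ω → Fin L → ℝ) (n : ℕ) (ω : Ω) :
    Matrix (Fin L) (Fin L) ℝ :=
  (n : ℝ)⁻¹ • ∑ i ∈ Finset.range n, vecMulVec (W i ω) (W i ω)

/-- The test statistic: the infimum of `‖P_L ∘ (K̂ - Θ)‖_F²` over all `L × L` matrices `Θ` of rank
at most `q`, as a function of `K̂`. -/
def testStat {L : ℕ} (q : ℕ) (Khat : Matrix (Fin L) (Fin L) ℝ) : ℝ :=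
  ⨅ Θ : {Θ : Matrix (Fin L) (Fin L) ℝ // Θ.rank ≤ q}, offDiagLoss Khat Θ.1

/-- The random matrix `Z` is a weak limit of `√n (K̂_n - K)`. -/
def IsFluctuationLimit {Ω Ω' : Type*} [MeasurableSpace Ω] [MeasurableSpace Ω']
    (P : Measure Ω) [IsProbabilityMeasure P] (P' : Measure Ω') [IsProbabilityMeasure P'] {L : ℕ}
    (W : ℕ → Ω → Fin L → ℝ) (K : Matrix (Fin L) (Fin L) ℝ)
    (Z : Ω' → Matrix (Fin L) (Fin L) ℝ) : Prop :=
  TendstoInDistribution (fun (n : ℕ) ω => vec (√(n : ℝ) • (empCov W n ω - K))) atTop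
    (fun ω' => vec (Z ω')) (fun _ => P) P'

end OffDiagRank

end

/-!
# Off-diagonal rank tests for covariance kernels

*The grid size.* The rank of the integral operator of a continuous kernel is the largest `r` for
which some minor `det (k(u_i, w_j))` of size `r` is nonzero (`hasKernelMinor_of_le_kernelRank`,
`rank_le_of_kernelRank_eq`). A nonzero minor persists in a neighbourhood of its nodes, and on a fine
regular grid every neighbourhood contains many nodes. By Hall's theorem the minor is therefore
reproduced by a block of `K_{X,L}` whose row indices, column indices and any prescribed index `i`
are all distinct (`exists_grid_minor`). Such a block does not touch the diagonal. If its size is the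
rank `q`, the vanishing bordered minors express the `i`-th diagonal entry of any matrix of rank at
most `q` through its off-diagonal entries (`submatrix_eq_skeleton`), hence uniqueness; if its size
is `q + 1`, matrices of rank at most `q` stay at a positive distance.

*The null hypothesis.* Let `K_{X,L} = C Cᵀ` and let `E` be a small symmetric perturbation. By the
recovery of the diagonal, competitive matrices `Θ` of rank at most `q` are within `O(‖E‖)` of `C Cᵀ`
(`norm_sub_le_mask`), and thus within `O(‖E‖²)` of the tangent space
`{C Cᵀ + C Uᵀ + V Cᵀ}` (`exists_tangent_approx`). The test statistic is then, up to `O(‖E‖³)`, the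
squared distance of `P_L ∘ E` to the image of the tangent space under the mask. As `E` is symmetric,
symmetric tangent vectors `C Sᵀ + S Cᵀ` suffice (`limitForm_le_tangent`). Since
`∇²Ψ(C)` is twice the Gram form of `S ↦ P_L ∘ (C Sᵀ + S Cᵀ)` (`hessPsi_form`), the normal
equations of this least-squares problem are solved by any generalized inverse of the Hessian, and
the squared distance is `limitForm C G E` (`limitForm_eq_residual`). The cubic error becomes
negligible after scaling by `n` (`testStat_sub_limitForm_le`, `tendstoInMeasure_zero_of_le`), and
the continuous mapping theorem gives the limit.

*The remaining parts.* The measurement vectors are independent and identically distributed, so the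
fluctuations have a Gaussian limit by the multivariate central limit theorem, deduced from the
one-dimensional one and Lévy's continuity theorem (`tendstoInDistribution_vector_clt`). Under the
alternative the strong law of large numbers keeps the test statistic above a positive constant.
-/

namespace OffDiagRank

/-! ### Rank factorization through an invertible compression -/

section Skeleton

variable {ι m n : Type*} [Fintype ι] [DecidableEq ι] [Fintype m] [Fintype n]

theorem card_le_rank_of_compression {Θ : Matrix m n ℝ} {A : Matrix ι m ℝ} {B : Matrix n ι ℝ}
    (hN : IsUnit (A * Θ * B).det) : Fintype.card ι ≤ Θ.rank := by
  rw [← rank_of_isUnit _ ((isUnit_iff_isUnit_det _).2 hN)]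
  exact (rank_mul_le_left _ _).trans (rank_mul_le_right _ _)

/-- A matrix of rank at most `q` is determined by its products with `A` and `B`, as soon as the
`q × q` compression `A Θ B` is invertible. With coordinate selections for `A` and `B` this says
that the `(q + 1) × (q + 1)` minors bordering an invertible `q × q` block vanish. -/
theorem eq_skeleton {Θ : Matrix m n ℝ} {A : Matrix ι m ℝ} {B : Matrix n ι ℝ}
    (hN : IsUnit (A * Θ * B).det) (hr : Θ.rank ≤ Fintype.card ι) :
    Θ = Θ * B * (A * Θ * B)⁻¹ * (A * Θ) := by
  classical
  have h1 : LinearMap.range (Θ * B).mulVecLin = LinearMap.range Θ.mulVecLin := by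
    apply Submodule.eq_of_le_of_finrank_le
    · rw [mulVecLin_mul]; exact LinearMap.range_comp_le_range _ _
    · have h2 : Fintype.card ι ≤ (Θ * B).rank := by
        apply card_le_rank_of_compression (A := A) (B := (1 : Matrix ι ι ℝ))
        rwa [Matrix.mul_one, ← Matrix.mul_assoc]
      exact hr.trans h2
  have h3 : ∀ j : n, ∃ x : ι → ℝ, (Θ * B) *ᵥ x = Θ *ᵥ Pi.single j 1 := by
    intro j
    have : Θ.mulVecLin (Pi.single j 1) ∈ LinearMap.range (Θ * B).mulVecLin := by
      rw [h1]; exact LinearMap.mem_range_self _ _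
    obtain ⟨x, hx⟩ := this
    exact ⟨x, hx⟩
  choose x hx using h3
  have h4 : Θ = Θ * B * (Matrix.of fun i j => x j i) := by
    ext i j
    have := congrFun (hx j) i
    rw [mulVec_single_one] at this
    simpa [mulVec, dotProduct, Matrix.mul_apply] using this.symm
  have h5 : A * Θ = (A * Θ * B) * (Matrix.of fun i j => x j i) := by
    conv_lhs => rw [h4]
    simp only [Matrix.mul_assoc]
  have h6 : (A * Θ * B)⁻¹ * (A * Θ) = Matrix.of fun i j => x j i :=
    (congrArg (fun Y => (A * Θ * B)⁻¹ * Y) h5).trans (nonsing_inv_mul_cancel_left _ _ hN)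
  rw [Matrix.mul_assoc (Θ * B), h6, ← h4]

end Skeleton

/-! ### The Frobenius norm -/

attribute [local instance] Matrix.frobeniusNormedAddCommGroup Matrix.frobeniusNormedSpace

section Frobenius

variable {l m n : ℕ}

theorem norm_sq_eq_vec (A : Matrix (Fin m) (Fin n) ℝ) : ‖A‖ ^ 2 = vec A ⬝ᵥ vec A := by
  have h0 : 0 ≤ ∑ i, ∑ j, ‖A i j‖ ^ (2 : ℝ) := by positivity
  rw [frobenius_norm_def, ← Real.sqrt_eq_rpow, Real.sq_sqrt h0, dotProduct, Fintype.sum_prod_type,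
    Finset.sum_comm]
  simp [vec, pow_two]

theorem frobSq_eq_norm_sq (A : Matrix (Fin m) (Fin n) ℝ) : frobSq A = ‖A‖ ^ 2 := by
  rw [norm_sq_eq_vec, frobSq, vec_dotProduct_vec]

theorem norm_eq_sqrt_vec (A : Matrix (Fin m) (Fin n) ℝ) : ‖A‖ = √(vec A ⬝ᵥ vec A) := by
  rw [← norm_sq_eq_vec, Real.sqrt_sq (norm_nonneg _)]

theorem norm_sq_eq_sum (A : Matrix (Fin m) (Fin n) ℝ) : ‖A‖ ^ 2 = ∑ i, ∑ j, A i j ^ 2 := by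
  rw [norm_sq_eq_vec, dotProduct, Fintype.sum_prod_type, Finset.sum_comm]
  simp [vec, pow_two]

theorem abs_entry_le_norm (A : Matrix (Fin m) (Fin n) ℝ) (i : Fin m) (j : Fin n) :
    |A i j| ≤ ‖A‖ := by
  apply abs_le_of_sq_le_sq _ (norm_nonneg _)
  rw [norm_sq_eq_sum]
  exact (Finset.single_le_sum (f := fun j => A i j ^ 2) (fun j _ => sq_nonneg _)
    (Finset.mem_univ j)).trans (Finset.single_le_sum (f := fun i => ∑ j, A i j ^ 2)
      (fun i _ => Finset.sum_nonneg fun j _ => sq_nonneg _) (Finset.mem_univ i))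

theorem norm_le_of_entries (A : Matrix (Fin m) (Fin n) ℝ) {e : ℝ} (he : 0 ≤ e)
    (h : ∀ i j, |A i j| ≤ e) : ‖A‖ ≤ (m * n) * e := by
  apply le_of_sq_le_sq _ (by positivity)
  rw [norm_sq_eq_sum]
  calc ∑ i, ∑ j, A i j ^ 2 ≤ ∑ _i : Fin m, ∑ _j : Fin n, e ^ 2 := by
        refine Finset.sum_le_sum fun i _ => Finset.sum_le_sum fun j _ => ?_
        exact sq_le_sq' (abs_le.1 (h i j)).1 (abs_le.1 (h i j)).2
    _ = ((m * n : ℕ) : ℝ) * e ^ 2 := by simp [mul_assoc]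
    _ ≤ ((m * n : ℕ) : ℝ) ^ 2 * e ^ 2 := by
        gcongr
        exact_mod_cast Nat.le_self_pow two_ne_zero _
    _ = _ := by push_cast; ring

theorem norm_mask_le (A : Matrix (Fin l) (Fin l) ℝ) : ‖offDiag l ⊙ A‖ ≤ ‖A‖ := by
  apply le_of_sq_le_sq _ (norm_nonneg _)
  rw [norm_sq_eq_sum, norm_sq_eq_sum]
  refine Finset.sum_le_sum fun i _ => Finset.sum_le_sum fun j _ => ?_
  by_cases h : i = j <;> simp [offDiag, h, sq_nonneg]

theorem mask_apply_of_ne (A : Matrix (Fin l) (Fin l) ℝ) {i j : Fin l} (h : i ≠ j) :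
    (offDiag l ⊙ A) i j = A i j := by
  simp [offDiag, h]

theorem mask_transpose (A : Matrix (Fin l) (Fin l) ℝ) :
    (offDiag l ⊙ A)ᵀ = offDiag l ⊙ Aᵀ := by
  ext i j
  simp [offDiag, eq_comm]

theorem mask_sub (A B : Matrix (Fin l) (Fin l) ℝ) :
    offDiag l ⊙ (A - B) = offDiag l ⊙ A - offDiag l ⊙ B := by
  ext i j
  simp [mul_sub]

theorem mask_add (A B : Matrix (Fin l) (Fin l) ℝ) :
    offDiag l ⊙ (A + B) = offDiag l ⊙ A + offDiag l ⊙ B := hadamard_add ..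

theorem mask_smul (c : ℝ) (A : Matrix (Fin l) (Fin l) ℝ) :
    offDiag l ⊙ (c • A) = c • (offDiag l ⊙ A) := hadamard_smul ..

theorem offDiagLoss_eq (K Θ : Matrix (Fin l) (Fin l) ℝ) :
    offDiagLoss K Θ = ‖offDiag l ⊙ (K - Θ)‖ ^ 2 := frobSq_eq_norm_sq _

theorem norm_mul_le_frob {p : ℕ} (A : Matrix (Fin l) (Fin m) ℝ) (B : Matrix (Fin m) (Fin p) ℝ) :
    ‖A * B‖ ≤ ‖A‖ * ‖B‖ := frobenius_norm_mul A B

/-- Quantitative openness of the set of invertible matrices. -/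
theorem inverse_bound_near {q : ℕ} {N₀ : Matrix (Fin q) (Fin q) ℝ} (h₀ : IsUnit N₀.det) :
    ∃ δ > 0, ∃ c > 0, ∀ N : Matrix (Fin q) (Fin q) ℝ, ‖N - N₀‖ ≤ δ →
      IsUnit N.det ∧ ‖N⁻¹‖ ≤ c := by
  set a := ‖N₀⁻¹‖ with ha
  have ha0 : 0 ≤ a := norm_nonneg _
  have key : ∀ N : Matrix (Fin q) (Fin q) ℝ, ‖N - N₀‖ ≤ 1 / (2 * a + 1) → ∀ (p : ℕ)
      (X : Matrix (Fin q) (Fin p) ℝ), ‖X‖ ≤ 2 * a * ‖N * X‖ := by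
    intro N hN p X
    have e1 : X = N₀⁻¹ * (N * X - (N - N₀) * X) := by
      rw [← Matrix.sub_mul, sub_sub_cancel, nonsing_inv_mul_cancel_left _ _ h₀]
    have e2 : ‖X‖ ≤ a * (‖N * X‖ + 1 / (2 * a + 1) * ‖X‖) := by
      calc ‖X‖ = ‖N₀⁻¹ * (N * X - (N - N₀) * X)‖ := by rw [← e1]
        _ ≤ a * ‖N * X - (N - N₀) * X‖ := norm_mul_le_frob _ _
        _ ≤ a * (‖N * X‖ + ‖(N - N₀) * X‖) := by gcongr; exact norm_sub_le _ _
        _ ≤ _ := by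
          gcongr
          exact (norm_mul_le_frob _ _).trans (by gcongr)
    have e3 : a * (1 / (2 * a + 1)) ≤ 1 / 2 := by
      rw [mul_one_div, div_le_div_iff₀ (by positivity) (by positivity)]; linarith
    nlinarith [norm_nonneg X, norm_nonneg (N * X)]
  refine ⟨1 / (2 * a + 1), by positivity, 2 * a * ‖(1 : Matrix (Fin q) (Fin q) ℝ)‖ + 1,
    by positivity, fun N hN => ?_⟩
  have hu : IsUnit N.det := by
    rw [isUnit_iff_ne_zero]
    intro hdet
    obtain ⟨v, hv, hNv⟩ := exists_mulVec_eq_zero_iff.2 hdet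
    have := key N hN 1 (replicateCol (Fin 1) v)
    rw [← replicateCol_mulVec, hNv, replicateCol_zero, norm_zero, mul_zero] at this
    have h0 := norm_le_zero_iff.1 this
    exact hv (by ext i; exact congrFun (congrFun h0 i) 0)
  refine ⟨hu, ?_⟩
  have := key N hN q N⁻¹
  rw [mul_nonsing_inv _ hu] at this
  linarith

end Frobenius

/-! ### Recovering the diagonal of a low-rank matrix -/

theorem submatrix_eq_skeleton {ι m n α β : Type*} [Fintype ι] [DecidableEq ι] [Fintype m]
    [Fintype n] [DecidableEq m] [DecidableEq n] {Θ : Matrix m n ℝ} {Rw : ι → m} {Cl : ι → n}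
    (hN : IsUnit (Θ.submatrix Rw Cl).det) (hr : Θ.rank ≤ Fintype.card ι) (f : α → m) (g : β → n) :
    Θ.submatrix f g = Θ.submatrix f Cl * (Θ.submatrix Rw Cl)⁻¹ * Θ.submatrix Rw g := by
  have e1 : (1 : Matrix m m ℝ).submatrix Rw id * Θ = Θ.submatrix Rw id := by
    ext a b; simp [Matrix.mul_apply, Matrix.one_apply]
  have e2 : Θ * (1 : Matrix n n ℝ).submatrix id Cl = Θ.submatrix id Cl := by
    ext a b; simp [Matrix.mul_apply, Matrix.one_apply]
  have e3 : Θ.submatrix Rw id * (1 : Matrix n n ℝ).submatrix id Cl = Θ.submatrix Rw Cl := by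
    ext a b; simp [Matrix.mul_apply, Matrix.one_apply]
  have h := eq_skeleton (Θ := Θ) (A := (1 : Matrix m m ℝ).submatrix Rw id)
    (B := (1 : Matrix n n ℝ).submatrix id Cl) (by rw [e1, e3]; exact hN) hr
  rw [e1, e2, e3] at h
  conv_lhs => rw [h]
  ext a b
  simp [Matrix.mul_apply]

theorem card_le_rank_of_minor {ι m n : Type*} [Fintype ι] [DecidableEq ι] [Fintype m]
    [Fintype n] {Θ : Matrix m n ℝ} {Rw : ι → m} {Cl : ι → n}
    (hN : IsUnit (Θ.submatrix Rw Cl).det) : Fintype.card ι ≤ Θ.rank := by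
  rw [← rank_of_isUnit _ ((isUnit_iff_isUnit_det _).2 hN)]
  exact rank_submatrix_le _ _ _

/-- `K` has an invertible `r × r` block that lies off the diagonal (no row index is a column
index) and avoids both the row and the column `i`. -/
def HasOffDiagMinor {L : ℕ} (K : Matrix (Fin L) (Fin L) ℝ) (r : ℕ) (i : Fin L) : Prop :=
  ∃ Rw Cl : Fin r → Fin L, (∀ a b, Rw a ≠ Cl b) ∧ (∀ a, Rw a ≠ i) ∧ (∀ a, Cl a ≠ i) ∧
    IsUnit (K.submatrix Rw Cl).det

section Recovery

variable {L r : ℕ} {K Θ : Matrix (Fin L) (Fin L) ℝ}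

/-- Each diagonal entry is expressed by the same skeleton formula in terms of equal off-diagonal
entries. -/
theorem eq_of_mask_eq (hK : K.rank ≤ r) (hΘ : Θ.rank ≤ r) (hmin : ∀ i, HasOffDiagMinor K r i)
    (h : offDiag L ⊙ Θ = offDiag L ⊙ K) : Θ = K := by
  have hoff : ∀ i j, i ≠ j → Θ i j = K i j := by
    intro i j hij
    rw [← mask_apply_of_ne Θ hij, h, mask_apply_of_ne K hij]
  ext i j
  by_cases hij : i = j
  · subst hij
    obtain ⟨Rw, Cl, hRC, hRw, hCl, hdet⟩ := hmin i
    have e1 : Θ.submatrix Rw Cl = K.submatrix Rw Cl := by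
      ext a b; exact hoff _ _ (hRC a b)
    have e2 : Θ.submatrix (fun _ : Unit => i) Cl = K.submatrix (fun _ : Unit => i) Cl := by
      ext a b; exact hoff _ _ (hCl b).symm
    have e3 : Θ.submatrix Rw (fun _ : Unit => i) = K.submatrix Rw (fun _ : Unit => i) := by
      ext a b; exact hoff _ _ (hRw a)
    have s1 := submatrix_eq_skeleton (Θ := Θ) (Rw := Rw) (Cl := Cl) (by rwa [e1]) (by simpa using hΘ)
      (fun _ : Unit => i) (fun _ : Unit => i)
    have s2 := submatrix_eq_skeleton (Θ := K) (Rw := Rw) (Cl := Cl) hdet (by simpa using hK)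
      (fun _ : Unit => i) (fun _ : Unit => i)
    rw [e1, e2, e3, ← s2] at s1
    exact congrFun (congrFun s1 ()) ()
  · exact hoff i j hij

/-- A small change of the off-diagonal entries changes an off-diagonal block only a little. -/
theorem norm_submatrix_sub_le {p s : ℕ} {Rw : Fin p → Fin L} {Cl : Fin s → Fin L}
    (h : ∀ a b, Rw a ≠ Cl b) :
    ‖Θ.submatrix Rw Cl - K.submatrix Rw Cl‖ ≤ (p * s) * ‖offDiag L ⊙ (Θ - K)‖ := by
  refine norm_le_of_entries _ (norm_nonneg _) fun a b => ?_
  have := abs_entry_le_norm (offDiag L ⊙ (Θ - K)) (Rw a) (Cl b)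
  rwa [mask_apply_of_ne _ (h a b)] at this

/-- Near `K`, a diagonal entry of a matrix of rank at most `r` is a Lipschitz function of its
off-diagonal entries. -/
theorem diag_entry_lipschitz (hK : K.rank ≤ r) {i : Fin L} (hmin : HasOffDiagMinor K r i) :
    ∃ δ > 0, ∃ c > 0, ∀ Θ : Matrix (Fin L) (Fin L) ℝ, Θ.rank ≤ r → ‖offDiag L ⊙ (Θ - K)‖ ≤ δ →
      |Θ i i - K i i| ≤ c * ‖offDiag L ⊙ (Θ - K)‖ := by
  obtain ⟨Rw, Cl, hRC, hRw, hCl, hdet⟩ := hmin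
  obtain ⟨δ, hδ, c, hc, hinv⟩ := inverse_bound_near hdet
  set a₀ := K.submatrix (fun _ : Fin 1 => i) Cl with ha₀
  set b₀ := K.submatrix Rw (fun _ : Fin 1 => i) with hb₀
  set N₀ := K.submatrix Rw Cl with hN₀
  refine ⟨min (δ / (r * r + 1)) 1, by positivity,
    r * c * (‖b₀‖ + r) + ‖a₀‖ * (c * (r * r) * ‖N₀⁻¹‖) * (‖b₀‖ + r) + ‖a₀‖ * ‖N₀⁻¹‖ * r + 1,
    by positivity, fun Θ hΘ hle => ?_⟩
  set e := ‖offDiag L ⊙ (Θ - K)‖ with he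
  have he0 : 0 ≤ e := norm_nonneg _
  have he1 : e ≤ 1 := hle.trans (min_le_right _ _)
  set a := Θ.submatrix (fun _ : Fin 1 => i) Cl with ha
  set b := Θ.submatrix Rw (fun _ : Fin 1 => i) with hb
  set N := Θ.submatrix Rw Cl with hN
  have dN : ‖N - N₀‖ ≤ (r * r) * e := norm_submatrix_sub_le hRC
  have da : ‖a - a₀‖ ≤ r * e := by
    simpa using norm_submatrix_sub_le (Θ := Θ) (K := K) (Rw := fun _ : Fin 1 => i) (Cl := Cl)
      (fun _ b => (hCl b).symm)
  have db : ‖b - b₀‖ ≤ r * e := by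
    simpa using norm_submatrix_sub_le (Θ := Θ) (K := K) (Cl := fun _ : Fin 1 => i) (Rw := Rw)
      (fun a _ => hRw a)
  have hNδ : ‖N - N₀‖ ≤ δ := by
    refine dN.trans ?_
    have h1 := hle.trans (min_le_left _ _)
    rw [le_div_iff₀ (by positivity)] at h1
    nlinarith
  obtain ⟨hNu, hNinv⟩ := hinv N hNδ
  have s1 := submatrix_eq_skeleton (Θ := Θ) (Rw := Rw) (Cl := Cl) hNu (by simpa using hΘ)
      (fun _ : Fin 1 => i) (fun _ : Fin 1 => i)
  have s2 := submatrix_eq_skeleton (Θ := K) (Rw := Rw) (Cl := Cl) hdet (by simpa using hK)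
      (fun _ : Fin 1 => i) (fun _ : Fin 1 => i)
  have hdiff : N⁻¹ - N₀⁻¹ = N⁻¹ * (N₀ - N) * N₀⁻¹ := by
    rw [Matrix.mul_sub, Matrix.sub_mul, nonsing_inv_mul _ hNu, Matrix.one_mul, Matrix.mul_assoc,
      mul_nonsing_inv _ hdet, Matrix.mul_one]
  have hsplit : a * N⁻¹ * b - a₀ * N₀⁻¹ * b₀ =
      (a - a₀) * N⁻¹ * b + a₀ * (N⁻¹ * (N₀ - N) * N₀⁻¹) * b + a₀ * N₀⁻¹ * (b - b₀) := by
    rw [← hdiff]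
    simp only [Matrix.sub_mul, Matrix.mul_sub]
    abel
  have hbn : ‖b‖ ≤ ‖b₀‖ + r := by
    calc ‖b‖ ≤ ‖b₀‖ + ‖b - b₀‖ := norm_le_norm_add_norm_sub' _ _
      _ ≤ ‖b₀‖ + r * 1 := by gcongr; exact db.trans (by gcongr)
      _ = _ := by ring
  have hbound : ‖a * N⁻¹ * b - a₀ * N₀⁻¹ * b₀‖ ≤
      (r * e) * c * (‖b₀‖ + r) + ‖a₀‖ * (c * ((r * r) * e) * ‖N₀⁻¹‖) * (‖b₀‖ + r)
        + ‖a₀‖ * ‖N₀⁻¹‖ * (r * e) := by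
    rw [hsplit]
    refine (norm_add_le _ _).trans (add_le_add ((norm_add_le _ _).trans (add_le_add ?_ ?_)) ?_)
    · refine (norm_mul_le_frob _ _).trans ?_
      gcongr
      exact (norm_mul_le_frob _ _).trans (by gcongr)
    · refine (norm_mul_le_frob _ _).trans ?_
      gcongr
      refine (norm_mul_le_frob _ _).trans ?_
      gcongr
      refine (norm_mul_le_frob _ _).trans ?_
      gcongr
      refine (norm_mul_le_frob _ _).trans ?_
      gcongr
      rwa [norm_sub_rev]
    · refine (norm_mul_le_frob _ _).trans ?_
      gcongr
      exact norm_mul_le_frob _ _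
  have hentry : Θ i i - K i i = (a * N⁻¹ * b - a₀ * N₀⁻¹ * b₀) 0 0 := by
    rw [← s1, ← s2]; simp
  rw [hentry]
  refine (abs_entry_le_norm _ _ _).trans (hbound.trans ?_)
  nlinarith

/-- Near `K`, a matrix of rank at most `r` is controlled by its off-diagonal entries. -/
theorem norm_sub_le_mask (hK : K.rank ≤ r) (hmin : ∀ i, HasOffDiagMinor K r i) :
    ∃ δ > 0, ∃ c > 0, ∀ Θ : Matrix (Fin L) (Fin L) ℝ, Θ.rank ≤ r → ‖offDiag L ⊙ (Θ - K)‖ ≤ δ →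
      ‖Θ - K‖ ≤ c * ‖offDiag L ⊙ (Θ - K)‖ := by
  choose δ hδ c hc hlip using fun i => diag_entry_lipschitz hK (hmin i)
  obtain ⟨δ', hδ', hδ'le⟩ : ∃ δ' > 0, ∀ i, δ' ≤ δ i := by
    have : ∀ᶠ x in 𝓝[>] (0 : ℝ), (∀ i, x ≤ δ i) ∧ 0 < x := by
      refine Filter.Eventually.and ?_ self_mem_nhdsWithin
      exact Filter.eventually_all.2 fun i => nhdsWithin_le_nhds (Iic_mem_nhds (hδ i))
    obtain ⟨x, hx⟩ := this.exists
    exact ⟨x, hx.2, hx.1⟩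
  have hcsum : ∀ i, c i ≤ ∑ j, c j := fun i =>
    Finset.single_le_sum (f := c) (fun j _ => (hc j).le) (Finset.mem_univ i)
  have hs0 : 0 ≤ ∑ j, c j := Finset.sum_nonneg fun j _ => (hc j).le
  refine ⟨δ', hδ', (L * L) * (∑ j, c j + 1) + 1, by positivity, fun Θ hΘ hle => ?_⟩
  set e := ‖offDiag L ⊙ (Θ - K)‖ with he
  have he0 : 0 ≤ e := norm_nonneg _
  have : ‖Θ - K‖ ≤ (L * L) * ((∑ j, c j + 1) * e) := by
    refine norm_le_of_entries _ (by positivity) fun i j => ?_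
    by_cases hij : i = j
    · subst hij
      refine (hlip i Θ hΘ (hle.trans (hδ'le i))).trans ?_
      gcongr
      exact (hcsum i).trans (by linarith)
    · have := abs_entry_le_norm (offDiag L ⊙ (Θ - K)) i j
      rw [mask_apply_of_ne _ hij] at this
      refine this.trans ?_
      nlinarith
  nlinarith

/-- An invertible off-diagonal block of size larger than `r` keeps all matrices of rank at most
`r` at a positive off-diagonal distance. -/
theorem exists_pos_le_mask {i : Fin L} (hmin : HasOffDiagMinor K (r + 1) i) :
    ∃ c > 0, ∀ Θ : Matrix (Fin L) (Fin L) ℝ, Θ.rank ≤ r → c ≤ ‖offDiag L ⊙ (Θ - K)‖ := by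
  obtain ⟨Rw, Cl, hRC, -, -, hdet⟩ := hmin
  obtain ⟨δ, hδ, _, _, hinv⟩ := inverse_bound_near hdet
  refine ⟨δ / ((r + 1) * (r + 1)), by positivity, fun Θ hΘ => ?_⟩
  by_contra! hlt
  rw [lt_div_iff₀ (by positivity)] at hlt
  have h1 := norm_submatrix_sub_le (Θ := Θ) (K := K) hRC
  have h2 := (hinv _ (h1.trans (by push_cast; linarith))).1
  have := card_le_rank_of_minor h2
  simp at this
  omega

end Recovery

/-- The second-order description of matrices of rank at most `q` near `C Cᵀ`: up to a quadratic
error they differ from `C Cᵀ` by a tangent vector `C U + V Cᵀ`. -/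
theorem exists_tangent_approx {L q : ℕ} {C : Matrix (Fin L) (Fin q) ℝ}
    {B : Matrix (Fin q) (Fin L) ℝ} (hBC : B * C = 1) :
    ∃ δ > 0, ∃ c > 0, ∀ Θ : Matrix (Fin L) (Fin L) ℝ, Θ.rank ≤ q → ‖Θ - C * Cᵀ‖ ≤ δ →
      ∃ U V : Matrix (Fin L) (Fin q) ℝ,
        ‖Θ - C * Cᵀ - (C * Uᵀ + V * Cᵀ)‖ ≤ c * ‖Θ - C * Cᵀ‖ ^ 2 := by
  obtain ⟨δ, hδ, c, hc, hinv⟩ :=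
    inverse_bound_near (N₀ := (1 : Matrix (Fin q) (Fin q) ℝ)) (by simp)
  set Q : Matrix (Fin L) (Fin L) ℝ := 1 - C * B with hQ
  refine ⟨δ / (‖B‖ * ‖B‖ + 1), by positivity, ‖Q‖ * ‖B‖ * c * ‖B‖ * ‖Q‖ + 1, by positivity,
    fun Θ hΘ hle => ?_⟩
  set D := Θ - C * Cᵀ with hD
  -- `Q` annihilates `C`, so `Q D Qᵀ = Q Θ Qᵀ` is the part of `D` transverse to the tangent space;
  -- the skeleton formula for `Θ` exhibits it as a quadratic expression in `D`
  have hQC : Q * C = 0 := by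
    rw [hQ, Matrix.sub_mul, Matrix.mul_assoc, hBC, Matrix.one_mul, Matrix.mul_one, sub_self]
  have hCQ : Cᵀ * Qᵀ = 0 := by rw [← transpose_mul, hQC, transpose_zero]
  have hCB : Cᵀ * Bᵀ = 1 := by rw [← transpose_mul, hBC, transpose_one]
  have hΘD : Θ = C * Cᵀ + D := by rw [hD]; abel
  have hN1 : B * Θ * Bᵀ - 1 = B * D * Bᵀ := by
    rw [hD, Matrix.mul_sub, Matrix.sub_mul, ← Matrix.mul_assoc B C, hBC, Matrix.one_mul, hCB]
  obtain ⟨hNu, hNinv⟩ := hinv (B * Θ * Bᵀ) (by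
    rw [hN1]
    calc ‖B * D * Bᵀ‖ ≤ ‖B‖ * ‖D‖ * ‖Bᵀ‖ :=
          (norm_mul_le_frob _ _).trans (by gcongr; exact norm_mul_le_frob _ _)
      _ = (‖B‖ * ‖B‖) * ‖D‖ := by rw [frobenius_norm_transpose]; ring
      _ ≤ δ := by
        rw [le_div_iff₀ (by positivity)] at hle
        nlinarith [norm_nonneg D, norm_nonneg B])
  have hsk := eq_skeleton hNu (by simpa using hΘ)
  have hQΘ : Q * Θ = Q * D := by
    rw [hΘD, Matrix.mul_add, ← Matrix.mul_assoc, hQC, Matrix.zero_mul, zero_add]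
  have hΘQ : Θ * Qᵀ = D * Qᵀ := by
    rw [hΘD, Matrix.add_mul, Matrix.mul_assoc C, hCQ, Matrix.mul_zero, zero_add]
  have hQDQ : Q * D * Qᵀ = Q * D * Bᵀ * (B * Θ * Bᵀ)⁻¹ * (B * D * Qᵀ) := by
    calc Q * D * Qᵀ = Q * Θ * Qᵀ := by rw [hQΘ]
      _ = Q * (Θ * Bᵀ * (B * Θ * Bᵀ)⁻¹ * (B * Θ)) * Qᵀ := by rw [← hsk]
      _ = (Q * Θ) * Bᵀ * (B * Θ * Bᵀ)⁻¹ * (B * (Θ * Qᵀ)) := by simp only [Matrix.mul_assoc]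
      _ = _ := by rw [hQΘ, hΘQ]; simp only [Matrix.mul_assoc]
  refine ⟨(B * D)ᵀ, D * Bᵀ - C * (B * D * Bᵀ), ?_⟩
  have htan : D - (C * ((B * D)ᵀ)ᵀ + (D * Bᵀ - C * (B * D * Bᵀ)) * Cᵀ) = Q * D * Qᵀ := by
    rw [hQ]
    simp only [transpose_transpose, transpose_sub, transpose_one, transpose_mul, Matrix.sub_mul,
      Matrix.mul_sub, Matrix.one_mul, Matrix.mul_one, Matrix.mul_assoc]
    abel
  rw [htan, hQDQ]
  have hQBn : ‖Q * D * Bᵀ‖ ≤ ‖Q‖ * ‖D‖ * ‖B‖ := by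
    rw [← frobenius_norm_transpose B]
    exact (norm_mul_le_frob _ _).trans (by gcongr; exact norm_mul_le_frob _ _)
  have hBQn : ‖B * D * Qᵀ‖ ≤ ‖B‖ * ‖D‖ * ‖Q‖ := by
    rw [← frobenius_norm_transpose Q]
    exact (norm_mul_le_frob _ _).trans (by gcongr; exact norm_mul_le_frob _ _)
  calc ‖Q * D * Bᵀ * (B * Θ * Bᵀ)⁻¹ * (B * D * Qᵀ)‖
      ≤ (‖Q‖ * ‖D‖ * ‖B‖) * c * (‖B‖ * ‖D‖ * ‖Q‖) := by
        refine (norm_mul_le_frob _ _).trans ?_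
        gcongr
        exact (norm_mul_le_frob _ _).trans (by gcongr)
    _ ≤ _ := by nlinarith [sq_nonneg ‖D‖]

theorem rank_mul_transpose_le {L q : ℕ} (C : Matrix (Fin L) (Fin q) ℝ)
    (V : Matrix (Fin q) (Fin L) ℝ) : (C * V).rank ≤ q :=
  (rank_mul_le_left _ _).trans ((rank_le_width C))

/-- A square root factor with an invertible `q × q` block in its Gram matrix has a left inverse. -/
theorem exists_left_inverse {L q : ℕ} {C : Matrix (Fin L) (Fin q) ℝ} {i : Fin L}
    (hmin : HasOffDiagMinor (C * Cᵀ) q i) : ∃ B : Matrix (Fin q) (Fin L) ℝ, B * C = 1 := by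
  obtain ⟨Rw, Cl, -, -, -, hdet⟩ := hmin
  have e1 : (C * Cᵀ).submatrix Rw Cl = C.submatrix Rw id * Cᵀ.submatrix id Cl := by
    ext a b; simp [Matrix.mul_apply]
  rw [e1, det_mul] at hdet
  have h2 := isUnit_of_mul_isUnit_left hdet
  refine ⟨(C.submatrix Rw id)⁻¹ * (1 : Matrix (Fin L) (Fin L) ℝ).submatrix Rw id, ?_⟩
  have e2 : (1 : Matrix (Fin L) (Fin L) ℝ).submatrix Rw id * C = C.submatrix Rw id := by
    ext a b; simp [Matrix.mul_apply, Matrix.one_apply]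
  rw [Matrix.mul_assoc, e2, nonsing_inv_mul _ h2]

/-! ### The Hessian of `Ψ` at an exact factorization -/

theorem dotProduct_hessian_mulVec {ι : Type*} [Fintype ι] [DecidableEq ι] (f : (ι → ℝ) → ℝ)
    (x v w : ι → ℝ) : v ⬝ᵥ hessian f x *ᵥ w = fderiv ℝ (fderiv ℝ f) x v w := by
  have hsum : ∀ u : ι → ℝ, u = ∑ a, u a • Pi.single a (1 : ℝ) := fun u => by
    simpa [← Pi.single_smul] using (Finset.univ_sum_single u).symm
  conv_rhs => rw [hsum v, hsum w]
  simp only [map_sum, map_smul, _root_.sum_apply, _root_.smul_apply,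
    smul_eq_mul, dotProduct, mulVec, hessian, of_apply, iteratedFDeriv_two_apply,
    Matrix.cons_val_zero, Matrix.cons_val_one]
  simp_rw [Finset.mul_sum]
  rw [Finset.sum_comm]
  exact Finset.sum_congr rfl fun a _ => Finset.sum_congr rfl fun b _ => by ring

/-- The derivative `S ↦ P_L ∘ (C Sᵀ + S Cᵀ)` of `C ↦ P_L ∘ C Cᵀ`. -/
def maskedTangent {L q : ℕ} (C : Matrix (Fin L) (Fin q) ℝ) :
    Matrix (Fin L) (Fin q) ℝ →ₗ[ℝ] Matrix (Fin L) (Fin L) ℝ where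
  toFun S := offDiag L ⊙ (C * Sᵀ + S * Cᵀ)
  map_add' S T := by
    rw [← mask_add, transpose_add, Matrix.mul_add, Matrix.add_mul]; congr 1; abel
  map_smul' c S := by
    rw [RingHom.id_apply, ← mask_smul, transpose_smul, Matrix.mul_smul, Matrix.smul_mul, smul_add]

theorem maskedTangent_apply {L q : ℕ} (C S : Matrix (Fin L) (Fin q) ℝ) :
    maskedTangent C S = offDiag L ⊙ (C * Sᵀ + S * Cᵀ) := rfl

/-- The differential at `y` of the quadratic map `y ↦ (Y Yᵀ)_{ij}`, `y = vec Y`. -/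
def gramEntryDeriv {L q : ℕ} (i j : Fin L) (y : Fin q × Fin L → ℝ) :
    (Fin q × Fin L → ℝ) →L[ℝ] ℝ :=
  ∑ b, (y (b, i) • ContinuousLinearMap.proj (R := ℝ) (φ := fun _ : Fin q × Fin L => ℝ) (b, j) +
    y (b, j) • ContinuousLinearMap.proj (R := ℝ) (φ := fun _ : Fin q × Fin L => ℝ) (b, i))

theorem hasFDerivAt_gramEntry {L q : ℕ} (i j : Fin L) (y : Fin q × Fin L → ℝ) :
    HasFDerivAt (fun y : Fin q × Fin L → ℝ => ∑ b, y (b, i) * y (b, j))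
      (gramEntryDeriv i j y) y := by
  refine HasFDerivAt.fun_sum fun b _ => ?_
  exact (hasFDerivAt_apply (𝕜 := ℝ) (b, i) y).mul (hasFDerivAt_apply (𝕜 := ℝ) (b, j) y)

theorem differentiable_gramEntryDeriv {L q : ℕ} (i j : Fin L) :
    Differentiable ℝ (gramEntryDeriv (q := q) i j) := by
  unfold gramEntryDeriv
  fun_prop

theorem gramEntryDeriv_vec {L q : ℕ} (i j : Fin L) (C S : Matrix (Fin L) (Fin q) ℝ) :
    gramEntryDeriv i j (vec C) (vec S) = (C * Sᵀ + S * Cᵀ) i j := by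
  simp [gramEntryDeriv, vec, Matrix.mul_apply, Finset.sum_add_distrib, mul_comm]

theorem Psi_eq_sum {L q : ℕ} (K : Matrix (Fin L) (Fin L) ℝ) (x : Fin q × Fin L → ℝ) :
    Psi K (Matrix.of fun a b => x (b, a)) =
      ∑ i, ∑ j, (offDiag L i j * (K i j - ∑ b, x (b, i) * x (b, j))) ^ 2 := by
  rw [Psi, offDiagLoss, frobSq_eq_norm_sq, norm_sq_eq_sum]
  simp [Matrix.mul_apply]

/-- Where the off-diagonal residual vanishes, the Hessian of the sum of squares `Ψ` is twice the
Gram form of the differential of the residual. -/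
theorem hessPsi_form {L q : ℕ} {K : Matrix (Fin L) (Fin L) ℝ} {C : Matrix (Fin L) (Fin q) ℝ}
    (hKC : offDiag L ⊙ (K - C * Cᵀ) = 0) (S T : Matrix (Fin L) (Fin q) ℝ) :
    vec S ⬝ᵥ hessPsi K C *ᵥ vec T = 2 * (vec (maskedTangent C S) ⬝ᵥ vec (maskedTangent C T)) := by
  rw [hessPsi, dotProduct_hessian_mulVec]
  set p := offDiag L with hp
  let g : Fin L → Fin L → (Fin q × Fin L → ℝ) → ℝ := fun i j y =>
    p i j * (K i j - ∑ b, y (b, i) * y (b, j))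
  let g' : Fin L → Fin L → (Fin q × Fin L → ℝ) → (Fin q × Fin L → ℝ) →L[ℝ] ℝ := fun i j y =>
    p i j • (-gramEntryDeriv i j y)
  have hg : ∀ i j y, HasFDerivAt (g i j) (g' i j y) y := fun i j y => by
    have := ((hasFDerivAt_gramEntry i j y).const_sub (K i j)).const_mul (p i j)
    exact this
  have hf : ∀ y, HasFDerivAt (fun x : Fin q × Fin L → ℝ => Psi K (Matrix.of fun a b => x (b, a)))
      (∑ i, ∑ j, (2 * g i j y) • g' i j y) y := by
    intro y
    simp_rw [Psi_eq_sum]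
    refine HasFDerivAt.fun_sum fun i _ => HasFDerivAt.fun_sum fun j _ => ?_
    simpa using (hg i j y).pow 2
  have hf' : fderiv ℝ (fun x : Fin q × Fin L → ℝ => Psi K (Matrix.of fun a b => x (b, a))) =
      fun y => ∑ i, ∑ j, (2 * g i j y) • g' i j y := funext fun y => (hf y).fderiv
  have hg0 : ∀ i j, g i j (vec C) = 0 := fun i j => by
    have := congrFun (congrFun hKC i) j
    simpa [g, vec, Matrix.mul_apply] using this
  have hdiff : ∀ i j, DifferentiableAt ℝ (g' i j) (vec C) := fun i j =>
    (differentiable_gramEntryDeriv i j _).fun_neg.fun_const_smul _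
  have h2 : HasFDerivAt (fun y => ∑ i, ∑ j, (2 * g i j y) • g' i j y)
      (∑ i, ∑ j, ((2 * g i j (vec C)) • fderiv ℝ (g' i j) (vec C) +
        ((2 : ℝ) • g' i j (vec C)).smulRight (g' i j (vec C)))) (vec C) := by
    refine HasFDerivAt.fun_sum fun i _ => HasFDerivAt.fun_sum fun j _ => ?_
    exact ((hg i j (vec C)).const_mul 2).smul (hdiff i j).hasFDerivAt
  have hval : ∀ i j, ((2 * g i j (vec C)) • fderiv ℝ (g' i j) (vec C) +
      ((2 : ℝ) • g' i j (vec C)).smulRight (g' i j (vec C))) (vec S) (vec T) =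
      2 * (p i j * -(C * Sᵀ + S * Cᵀ) i j) * (p i j * -(C * Tᵀ + T * Cᵀ) i j) := fun i j => by
    change (2 * g i j (vec C)) * fderiv ℝ (g' i j) (vec C) (vec S) (vec T) +
      (2 * (p i j * -gramEntryDeriv i j (vec C) (vec S))) *
        (p i j * -gramEntryDeriv i j (vec C) (vec T)) = _
    rw [hg0, gramEntryDeriv_vec, gramEntryDeriv_vec]
    ring
  rw [hf', h2.fderiv]
  simp only [_root_.sum_apply, hval]
  rw [dotProduct, Fintype.sum_prod_type, Finset.sum_comm, Finset.mul_sum]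
  refine Finset.sum_congr rfl fun i _ => ?_
  rw [Finset.mul_sum]
  refine Finset.sum_congr rfl fun j _ => ?_
  simp only [vec, maskedTangent_apply, hadamard_apply, ← hp]
  ring

theorem hessPsi_isSymm {L q : ℕ} {K : Matrix (Fin L) (Fin L) ℝ} {C : Matrix (Fin L) (Fin q) ℝ}
    (hKC : offDiag L ⊙ (K - C * Cᵀ) = 0) : (hessPsi K C)ᵀ = hessPsi K C := by
  have key : ∀ S T : Matrix (Fin L) (Fin q) ℝ, vec S ⬝ᵥ hessPsi K C *ᵥ vec T =
      vec T ⬝ᵥ hessPsi K C *ᵥ vec S := fun S T => by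
    rw [hessPsi_form hKC, hessPsi_form hKC, dotProduct_comm]
  ext a b
  have := key (Matrix.single b.2 b.1 1) (Matrix.single a.2 a.1 1)
  simpa [vec_single] using this

/-! ### The quadratic form of the limit as a least-squares residual -/

section LeastSquares

variable {L q : ℕ}

theorem vec_dotProduct_comm_transpose (A : Matrix (Fin L) (Fin L) ℝ)
    (B : Matrix (Fin L) (Fin L) ℝ) : vec Aᵀ ⬝ᵥ vec B = vec A ⬝ᵥ vec Bᵀ := by
  rw [vec_dotProduct_vec, vec_dotProduct_vec, transpose_transpose, ← trace_transpose,
    transpose_mul, Matrix.trace_mul_comm]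

theorem vec_dotProduct_mask (A B : Matrix (Fin L) (Fin L) ℝ) :
    vec A ⬝ᵥ vec (offDiag L ⊙ B) = vec (offDiag L ⊙ A) ⬝ᵥ vec B := by
  simp only [dotProduct, vec, hadamard_apply]
  exact Finset.sum_congr rfl fun _ _ => by ring

theorem mask_mask (A : Matrix (Fin L) (Fin L) ℝ) :
    offDiag L ⊙ (offDiag L ⊙ A) = offDiag L ⊙ A := by
  ext i j
  by_cases h : i = j <;> simp [offDiag, h]

/-- The adjoint of `maskedTangent C` on symmetric matrices is `E ↦ 2 (P_L ∘ E) C`. -/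
theorem maskedTangent_adjoint (C S : Matrix (Fin L) (Fin q) ℝ) {E : Matrix (Fin L) (Fin L) ℝ}
    (hE : Eᵀ = E) :
    vec (maskedTangent C S) ⬝ᵥ vec (offDiag L ⊙ E) = 2 * (vec S ⬝ᵥ vec ((offDiag L ⊙ E) * C)) := by
  have hsym : (offDiag L ⊙ E)ᵀ = offDiag L ⊙ E := by rw [mask_transpose, hE]
  rw [maskedTangent_apply, vec_dotProduct_mask, mask_mask, ← vec_dotProduct_mask]
  set e := offDiag L ⊙ E
  have h1 : vec (S * Cᵀ) ⬝ᵥ vec e = vec S ⬝ᵥ vec (e * C) := by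
    rw [vec_dotProduct_vec, vec_dotProduct_vec, transpose_mul, transpose_transpose,
      Matrix.mul_assoc, Matrix.trace_mul_comm, Matrix.mul_assoc]
  have h2 : vec (C * Sᵀ) ⬝ᵥ vec e = vec (S * Cᵀ) ⬝ᵥ vec e := by
    have : C * Sᵀ = (S * Cᵀ)ᵀ := by simp
    rw [this, vec_dotProduct_comm_transpose, hsym]
  rw [vec_add, add_dotProduct, h1, h2, h1]; ring

/-- The least-squares coefficient `S` of `P_L ∘ E` on the range of `maskedTangent C`: with a
generalized inverse `G` of the Hessian, `vec S = 4 G vec((P_L ∘ E) C)`. -/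
def lsCoeff (C : Matrix (Fin L) (Fin q) ℝ) (G : Matrix (Fin q × Fin L) (Fin q × Fin L) ℝ)
    (E : Matrix (Fin L) (Fin L) ℝ) : Matrix (Fin L) (Fin q) ℝ :=
  Matrix.of fun a b => 4 * (G *ᵥ vec ((offDiag L ⊙ E) * C)) (b, a)

theorem vec_lsCoeff (C : Matrix (Fin L) (Fin q) ℝ)
    (G : Matrix (Fin q × Fin L) (Fin q × Fin L) ℝ) (E : Matrix (Fin L) (Fin L) ℝ) :
    vec (lsCoeff C G E) = (4 : ℝ) • (G *ᵥ vec ((offDiag L ⊙ E) * C)) := by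
  ext ⟨b, a⟩; simp [lsCoeff, vec]

theorem exists_norm_lsCoeff_le (C : Matrix (Fin L) (Fin q) ℝ)
    (G : Matrix (Fin q × Fin L) (Fin q × Fin L) ℝ) :
    ∃ c, 0 ≤ c ∧ ∀ E, ‖lsCoeff C G E‖ ≤ c * ‖E‖ := by
  refine ⟨(L * q) * (4 * ((∑ p, ∑ p', |G p p'|) * ‖C‖)), by positivity, fun E => ?_⟩
  set e := (offDiag L ⊙ E) * C with he
  have hen : ‖e‖ ≤ ‖E‖ * ‖C‖ :=
    (norm_mul_le_frob _ _).trans (by gcongr; exact norm_mask_le E)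
  have hent : ∀ p, |vec e p| ≤ ‖E‖ * ‖C‖ := fun p => (abs_entry_le_norm e p.2 p.1).trans hen
  have : ‖lsCoeff C G E‖ ≤ (L * q) * (4 * ((∑ p, ∑ p', |G p p'|) * (‖E‖ * ‖C‖))) := by
    refine norm_le_of_entries _ (by positivity) fun a b => ?_
    rw [lsCoeff, of_apply, abs_mul, abs_of_pos (by norm_num : (0 : ℝ) < 4)]
    gcongr
    calc |(G *ᵥ vec e) (b, a)| ≤ ∑ p', |G (b, a) p' * vec e p'| := Finset.abs_sum_le_sum_abs _ _
      _ ≤ ∑ p', |G (b, a) p'| * (‖E‖ * ‖C‖) := by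
        refine Finset.sum_le_sum fun p' _ => ?_
        rw [abs_mul]; gcongr; exact hent p'
      _ = (∑ p', |G (b, a) p'|) * (‖E‖ * ‖C‖) := by rw [Finset.sum_mul]
      _ ≤ _ := by
        refine mul_le_mul_of_nonneg_right ?_ (by positivity)
        exact Finset.single_le_sum (f := fun p => ∑ p', |G p p'|)
          (fun p _ => Finset.sum_nonneg fun p' _ => abs_nonneg _) (Finset.mem_univ (b, a))
  calc _ ≤ _ := this
    _ = _ := by ring

variable {K : Matrix (Fin L) (Fin L) ℝ} {C : Matrix (Fin L) (Fin q) ℝ}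
  {G : Matrix (Fin q × Fin L) (Fin q × Fin L) ℝ}

/-- A vector orthogonal to the null space of the symmetric matrix `H` is fixed by `H G`, for every
generalized inverse `G`. -/
theorem ginv_mulVec_eq {ι : Type*} [Fintype ι] {H G : Matrix ι ι ℝ} (hH : Hᵀ = H)
    (hG : H * G * H = H) {w : ι → ℝ} (hw : ∀ y, H *ᵥ y = 0 → y ⬝ᵥ w = 0) :
    H *ᵥ (G *ᵥ w) = w := by
  have hGt : H * Gᵀ * H = H := by
    have := congrArg transpose hG
    rwa [transpose_mul, transpose_mul, hH, ← Matrix.mul_assoc] at this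
  refine sub_eq_zero.1 (dotProduct_eq_zero _ fun x => ?_)
  -- `Gᵀ` is a generalized inverse too, so `Gᵀ H x - x` lies in the null space of `H`
  have h1 : H *ᵥ ((Gᵀ * H) *ᵥ x - x) = 0 := by
    rw [mulVec_sub, mulVec_mulVec, ← Matrix.mul_assoc, hGt, sub_self]
  have h2 := hw _ h1
  have h3 : ((Gᵀ * H) *ᵥ x) ⬝ᵥ w = (H *ᵥ (G *ᵥ w)) ⬝ᵥ x := by
    rw [mulVec_mulVec, dotProduct_comm, dotProduct_mulVec, ← mulVec_transpose, transpose_mul,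
      transpose_transpose, hH]
  rw [sub_dotProduct, h3, sub_eq_zero] at h2
  rw [sub_dotProduct, h2, dotProduct_comm x, sub_self]

/-- The normal equations for the least-squares coefficient. -/
theorem lsCoeff_normal_eq (hKC : offDiag L ⊙ (K - C * Cᵀ) = 0)
    (hG : hessPsi K C * G * hessPsi K C = hessPsi K C) {E : Matrix (Fin L) (Fin L) ℝ}
    (hE : Eᵀ = E) (T : Matrix (Fin L) (Fin q) ℝ) :
    vec (maskedTangent C T) ⬝ᵥ vec (maskedTangent C (lsCoeff C G E)) =
      vec (maskedTangent C T) ⬝ᵥ vec (offDiag L ⊙ E) := by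
  have h1 := hessPsi_form hKC T (lsCoeff C G E)
  have h2 : hessPsi K C *ᵥ (G *ᵥ vec ((offDiag L ⊙ E) * C)) = vec ((offDiag L ⊙ E) * C) := by
    refine ginv_mulVec_eq (hessPsi_isSymm hKC) hG fun y hy => ?_
    obtain ⟨Y, rfl⟩ := vec_bijective.2 y
    have h3 := hessPsi_form hKC Y Y
    rw [hy, dotProduct_zero, ← norm_sq_eq_vec] at h3
    have h4 : maskedTangent C Y = 0 := by
      rw [← norm_eq_zero]; nlinarith [norm_nonneg (maskedTangent C Y)]
    have h5 := maskedTangent_adjoint C Y hE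
    rw [h4, vec_zero, zero_dotProduct] at h5
    linarith
  rw [vec_lsCoeff, mulVec_smul, h2, dotProduct_smul, smul_eq_mul] at h1
  rw [maskedTangent_adjoint C T hE]
  linarith

theorem limitForm_eq (C : Matrix (Fin L) (Fin q) ℝ)
    (G : Matrix (Fin q × Fin L) (Fin q × Fin L) ℝ) (E : Matrix (Fin L) (Fin L) ℝ) :
    limitForm C G E = ‖offDiag L ⊙ E‖ ^ 2 -
      8 * (vec ((offDiag L ⊙ E) * C) ⬝ᵥ (G *ᵥ vec ((offDiag L ⊙ E) * C))) := by
  have h1 : (Cᵀ ⊗ₖ (1 : Matrix (Fin L) (Fin L) ℝ)) *ᵥ vec (offDiag L ⊙ E) =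
      vec ((offDiag L ⊙ E) * C) := by
    rw [kronecker_mulVec_vec, transpose_transpose, Matrix.one_mul]
  have h2 : vec (offDiag L ⊙ E) ᵥ* (C ⊗ₖ (1 : Matrix (Fin L) (Fin L) ℝ)) =
      vec ((offDiag L ⊙ E) * C) := by
    rw [vec_vecMul_kronecker, transpose_one, Matrix.one_mul]
  rw [limitForm, frobSq_eq_norm_sq, ← mulVec_mulVec, h1, ← mulVec_mulVec, dotProduct_mulVec, h2]

theorem limitForm_eq_residual (hKC : offDiag L ⊙ (K - C * Cᵀ) = 0)
    (hG : hessPsi K C * G * hessPsi K C = hessPsi K C) {E : Matrix (Fin L) (Fin L) ℝ}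
    (hE : Eᵀ = E) :
    limitForm C G E = ‖offDiag L ⊙ E - maskedTangent C (lsCoeff C G E)‖ ^ 2 := by
  have h1 := lsCoeff_normal_eq hKC hG hE (lsCoeff C G E)
  have h2 := maskedTangent_adjoint C (lsCoeff C G E) hE
  rw [limitForm_eq, norm_sq_eq_vec (_ - _), vec_sub, sub_dotProduct, dotProduct_sub,
    dotProduct_sub, h1, sub_self, sub_zero, dotProduct_comm (vec (offDiag L ⊙ E)) (vec (maskedTangent C _)), h2,
    vec_lsCoeff, norm_sq_eq_vec, smul_dotProduct, smul_eq_mul, dotProduct_comm (G *ᵥ _)]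
  ring

theorem limitForm_le (hKC : offDiag L ⊙ (K - C * Cᵀ) = 0)
    (hG : hessPsi K C * G * hessPsi K C = hessPsi K C) {E : Matrix (Fin L) (Fin L) ℝ}
    (hE : Eᵀ = E) (S : Matrix (Fin L) (Fin q) ℝ) :
    limitForm C G E ≤ ‖offDiag L ⊙ E - maskedTangent C S‖ ^ 2 := by
  rw [limitForm_eq_residual hKC hG hE]
  set S₀ := lsCoeff C G E
  have h1 := lsCoeff_normal_eq hKC hG hE (S₀ - S)
  have h2 : offDiag L ⊙ E - maskedTangent C S =
      (offDiag L ⊙ E - maskedTangent C S₀) + maskedTangent C (S₀ - S) := by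
    rw [map_sub]; abel
  have h3 : vec (maskedTangent C (S₀ - S)) ⬝ᵥ vec (offDiag L ⊙ E - maskedTangent C S₀) = 0 := by
    rw [vec_sub, dotProduct_sub, h1, sub_self]
  rw [h2, norm_sq_eq_vec (_ + _), vec_add, add_dotProduct, dotProduct_add, dotProduct_add, h3,
    dotProduct_comm (vec (_ - _)) (vec (maskedTangent C (S₀ - S))), h3, ← norm_sq_eq_vec,
    ← norm_sq_eq_vec]
  nlinarith [sq_nonneg ‖maskedTangent C (S₀ - S)‖]

/-- For symmetric `E` nothing is gained by nonsymmetric tangent vectors `C Uᵀ + V Cᵀ`. -/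
theorem limitForm_le_tangent (hKC : offDiag L ⊙ (K - C * Cᵀ) = 0)
    (hG : hessPsi K C * G * hessPsi K C = hessPsi K C) {E : Matrix (Fin L) (Fin L) ℝ}
    (hE : Eᵀ = E) (U V : Matrix (Fin L) (Fin q) ℝ) :
    limitForm C G E ≤ ‖offDiag L ⊙ (E - (C * Uᵀ + V * Cᵀ))‖ ^ 2 := by
  refine (limitForm_le hKC hG hE ((1 / 2 : ℝ) • (U + V))).trans ?_
  set X := offDiag L ⊙ (E - (C * Uᵀ + V * Cᵀ)) with hX
  have h1 : offDiag L ⊙ E - maskedTangent C ((1 / 2 : ℝ) • (U + V)) =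
      (1 / 2 : ℝ) • (X + Xᵀ) := by
    rw [hX, mask_transpose, ← mask_add, ← mask_smul, maskedTangent_apply, ← mask_sub]
    congr 1
    simp only [transpose_sub, transpose_add, transpose_mul, transpose_transpose, hE,
      transpose_smul, Matrix.mul_smul, Matrix.smul_mul, Matrix.mul_add, Matrix.add_mul]
    module
  have h2 : ‖(1 / 2 : ℝ) • (X + Xᵀ)‖ ≤ ‖X‖ := by
    rw [norm_smul, Real.norm_of_nonneg (by norm_num)]
    have := norm_add_le X Xᵀ
    rw [frobenius_norm_transpose] at this
    linarith
  rw [h1]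
  gcongr

end LeastSquares

/-! ### Second-order expansion of the test statistic -/

section Expansion

variable {L q : ℕ}

theorem testStat_le (Khat : Matrix (Fin L) (Fin L) ℝ) {Θ : Matrix (Fin L) (Fin L) ℝ}
    (hΘ : Θ.rank ≤ q) : testStat q Khat ≤ ‖offDiag L ⊙ (Khat - Θ)‖ ^ 2 := by
  rw [← offDiagLoss_eq]
  refine ciInf_le (f := fun Θ : {Θ : Matrix (Fin L) (Fin L) ℝ // Θ.rank ≤ q} =>
    offDiagLoss Khat Θ.1) ⟨0, ?_⟩ ⟨Θ, hΘ⟩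
  rintro _ ⟨Θ, rfl⟩
  simp only [offDiagLoss_eq]
  positivity

theorem le_testStat {Khat : Matrix (Fin L) (Fin L) ℝ} {b : ℝ}
    (h : ∀ Θ : Matrix (Fin L) (Fin L) ℝ, Θ.rank ≤ q → b ≤ ‖offDiag L ⊙ (Khat - Θ)‖ ^ 2) :
    b ≤ testStat q Khat := by
  have : Nonempty {Θ : Matrix (Fin L) (Fin L) ℝ // Θ.rank ≤ q} := ⟨⟨0, by simp⟩⟩
  refine le_ciInf fun Θ => ?_
  rw [offDiagLoss_eq]
  exact h Θ.1 Θ.2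

theorem testStat_nonneg (Khat : Matrix (Fin L) (Fin L) ℝ) : 0 ≤ testStat q Khat :=
  le_testStat fun _ _ => by positivity

theorem le_sqrt_testStat {Khat : Matrix (Fin L) (Fin L) ℝ} {b : ℝ}
    (h : ∀ Θ : Matrix (Fin L) (Fin L) ℝ, Θ.rank ≤ q → b ≤ ‖offDiag L ⊙ (Khat - Θ)‖) :
    b ≤ √(testStat q Khat) := by
  rcases le_total b 0 with hb | hb
  · exact hb.trans (Real.sqrt_nonneg _)
  · exact Real.le_sqrt_of_sq_le (le_testStat fun Θ hΘ => by gcongr; exact h Θ hΘ)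

/-- For symmetric perturbations of `K`, with `K` equal to `C Cᵀ` off the diagonal, the test
statistic agrees with the quadratic form `limitForm` up to a cubic error. -/
theorem testStat_sub_limitForm_le {K : Matrix (Fin L) (Fin L) ℝ} {C : Matrix (Fin L) (Fin q) ℝ}
    {G : Matrix (Fin q × Fin L) (Fin q × Fin L) ℝ} (hKC : offDiag L ⊙ (K - C * Cᵀ) = 0)
    (hG : hessPsi K C * G * hessPsi K C = hessPsi K C)
    (hmin : ∀ i, HasOffDiagMinor (C * Cᵀ) q i) {B : Matrix (Fin q) (Fin L) ℝ} (hBC : B * C = 1) :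
    ∃ c, 0 ≤ c ∧ ∀ Khat : Matrix (Fin L) (Fin L) ℝ, (Khat - K)ᵀ = Khat - K →
      |testStat q Khat - limitForm C G (Khat - K)| ≤ c * ‖Khat - K‖ ^ 3 := by
  obtain ⟨cS, hcS, hS⟩ := exists_norm_lsCoeff_le C G
  obtain ⟨δ₁, hδ₁, c₁, hc₁, h₁⟩ := norm_sub_le_mask (rank_mul_transpose_le C Cᵀ) hmin
  obtain ⟨δ₂, hδ₂, c₂, hc₂, h₂⟩ := exists_tangent_approx hBC
  obtain ⟨δ, hδ, hδa, hδb⟩ : ∃ δ > 0, 2 * δ ≤ δ₁ ∧ c₁ * (2 * δ) ≤ δ₂ := by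
    refine ⟨min (δ₁ / 2) (δ₂ / (2 * c₁)), by positivity, ?_, ?_⟩
    · linarith [min_le_left (δ₁ / 2) (δ₂ / (2 * c₁))]
    · have := min_le_right (δ₁ / 2) (δ₂ / (2 * c₁))
      rw [le_div_iff₀ (by positivity)] at this
      linarith
  set M := cS ^ 2 + c₂ * (2 * c₁) ^ 2 + 1 / δ with hM
  have hM0 : 0 ≤ M := by positivity
  refine ⟨2 * M, by positivity, fun Khat hsymm => ?_⟩
  set E := Khat - K with hE
  set Qf := limitForm C G E with hQf
  set τ := testStat q Khat with hτ
  have hQ0 : 0 ≤ Qf := by rw [hQf, limitForm_eq_residual hKC hG hsymm]; positivity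
  have hτ0 : 0 ≤ τ := testStat_nonneg _
  -- the diagonal of `K` is invisible, so `C Cᵀ` may replace `K`
  have hmask : ∀ Θ, offDiag L ⊙ (Khat - Θ) = offDiag L ⊙ (E - (Θ - C * Cᵀ)) := fun Θ => by
    have : Khat - Θ = (E - (Θ - C * Cᵀ)) + (K - C * Cᵀ) := by rw [hE]; abel
    rw [this, mask_add, hKC, add_zero]
  have hQE : √Qf ≤ ‖E‖ := by
    rw [Real.sqrt_le_left (norm_nonneg _)]
    have := limitForm_le hKC hG hsymm 0
    rw [map_zero, sub_zero] at this
    exact this.trans (by gcongr; exact norm_mask_le E)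
  have hτE : √τ ≤ ‖E‖ := by
    rw [Real.sqrt_le_left (norm_nonneg _)]
    have := testStat_le Khat (rank_mul_transpose_le C Cᵀ)
    rw [hmask, sub_self, sub_zero] at this
    exact this.trans (by gcongr; exact norm_mask_le E)
  -- upper bound: the competitor `(C + S)(C + S)ᵀ` with the least-squares coefficient `S`
  have hupper : √τ ≤ √Qf + M * ‖E‖ ^ 2 := by
    set S := lsCoeff C G E with hSdef
    have h3 := testStat_le Khat (rank_mul_transpose_le (C + S) (C + S)ᵀ)
    have h4 : offDiag L ⊙ (Khat - (C + S) * (C + S)ᵀ) =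
        (offDiag L ⊙ E - maskedTangent C S) - offDiag L ⊙ (S * Sᵀ) := by
      rw [hmask, maskedTangent_apply, ← mask_sub, ← mask_sub]
      congr 1
      simp only [transpose_add, Matrix.add_mul, Matrix.mul_add]
      abel
    have h5 : √Qf = ‖offDiag L ⊙ E - maskedTangent C S‖ := by
      rw [hQf, limitForm_eq_residual hKC hG hsymm, Real.sqrt_sq (norm_nonneg _)]
    have h6 : ‖offDiag L ⊙ (S * Sᵀ)‖ ≤ (cS * ‖E‖) * (cS * ‖E‖) := by
      refine (norm_mask_le _).trans ((norm_mul_le_frob _ _).trans ?_)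
      rw [frobenius_norm_transpose]
      have := hS E
      gcongr
    have h7 : √τ ≤ ‖offDiag L ⊙ (Khat - (C + S) * (C + S)ᵀ)‖ := by
      rwa [Real.sqrt_le_left (norm_nonneg _)]
    rw [h4] at h7
    calc √τ ≤ _ := h7
      _ ≤ √Qf + cS * ‖E‖ * (cS * ‖E‖) := by
        rw [h5]; exact (norm_sub_le _ _).trans (by gcongr)
      _ = √Qf + cS ^ 2 * ‖E‖ ^ 2 := by ring
      _ ≤ _ := by
        gcongr
        rw [hM]
        have : 0 ≤ c₂ * (2 * c₁) ^ 2 + 1 / δ := by positivity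
        linarith
  have hlower : √Qf - M * ‖E‖ ^ 2 ≤ √τ := by
    refine le_sqrt_testStat fun Θ hΘ => ?_
    rw [hmask]
    -- for large `E` the bound is trivial, because `√Qf ≤ ‖E‖ ≤ ‖E‖² / δ`
    rcases lt_or_ge δ ‖E‖ with hbig | hsmall
    · have : ‖E‖ ≤ 1 / δ * ‖E‖ ^ 2 := by
        rw [one_div, inv_mul_eq_div, le_div_iff₀ hδ]; nlinarith
      have h8 : 1 / δ * ‖E‖ ^ 2 ≤ M * ‖E‖ ^ 2 := by
        gcongr
        rw [hM]
        have : 0 ≤ cS ^ 2 + c₂ * (2 * c₁) ^ 2 := by positivity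
        linarith
      linarith [norm_nonneg (offDiag L ⊙ (E - (Θ - C * Cᵀ)))]
    -- a `Θ` no better than `C Cᵀ` itself is harmless; a better one is close to `C Cᵀ`
    · rcases le_or_gt ‖E‖ ‖offDiag L ⊙ (E - (Θ - C * Cᵀ))‖ with hfar | hnear
      · have : 0 ≤ M * ‖E‖ ^ 2 := by positivity
        linarith
      · set D := Θ - C * Cᵀ with hD
        have hDE : ‖offDiag L ⊙ D‖ ≤ 2 * ‖E‖ := by
          have : offDiag L ⊙ D = offDiag L ⊙ E - offDiag L ⊙ (E - D) := by
            rw [← mask_sub, sub_sub_cancel]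
          rw [this]
          linarith [norm_sub_le (offDiag L ⊙ E) (offDiag L ⊙ (E - D)), norm_mask_le E]
        have hDn : ‖D‖ ≤ c₁ * (2 * ‖E‖) :=
          (h₁ Θ hΘ (hDE.trans (by linarith))).trans (by gcongr)
        obtain ⟨U, V, hUV⟩ := h₂ Θ hΘ (hDn.trans (le_trans (by gcongr) hδb))
        set Δ := C * Uᵀ + V * Cᵀ with hΔ
        have h9 : √Qf ≤ ‖offDiag L ⊙ (E - Δ)‖ := by
          rw [Real.sqrt_le_left (norm_nonneg _)]
          exact limitForm_le_tangent hKC hG hsymm U V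
        have h10 : offDiag L ⊙ (E - Δ) = offDiag L ⊙ (E - D) + offDiag L ⊙ (D - Δ) := by
          rw [← mask_add, sub_add_sub_cancel]
        have h11 : ‖offDiag L ⊙ (D - Δ)‖ ≤ M * ‖E‖ ^ 2 := by
          calc _ ≤ ‖D - Δ‖ := norm_mask_le _
            _ ≤ c₂ * ‖D‖ ^ 2 := hUV
            _ ≤ c₂ * (c₁ * (2 * ‖E‖)) ^ 2 := by gcongr
            _ = c₂ * (2 * c₁) ^ 2 * ‖E‖ ^ 2 := by ring
            _ ≤ M * ‖E‖ ^ 2 := by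
              gcongr
              rw [hM]
              have : 0 ≤ cS ^ 2 + 1 / δ := by positivity
              linarith
        rw [h10] at h9
        linarith [norm_add_le (offDiag L ⊙ (E - D)) (offDiag L ⊙ (D - Δ))]
  have hdiff : |√τ - √Qf| ≤ M * ‖E‖ ^ 2 := abs_le.2 ⟨by linarith, by linarith⟩
  have hfac : τ - Qf = (√τ - √Qf) * (√τ + √Qf) := by
    nlinarith [Real.mul_self_sqrt hτ0, Real.mul_self_sqrt hQ0]
  rw [hfac, abs_mul, abs_of_nonneg (by positivity : 0 ≤ √τ + √Qf)]
  calc |√τ - √Qf| * (√τ + √Qf) ≤ (M * ‖E‖ ^ 2) * (‖E‖ + ‖E‖) := by gcongr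
    _ = _ := by ring

end Expansion

/-! ### The rank of a kernel and its minors -/

section Kernel

variable {k : I → I → ℝ}

/-- The kernel has a nonvanishing `r × r` minor `det (k(u_i, w_j))`. -/
def HasKernelMinor (k : I → I → ℝ) (r : ℕ) : Prop :=
  ∃ u w : Fin r → I, (Matrix.of fun i j => k (u i) (w j)).det ≠ 0

theorem continuous_section (hcont : Continuous (Function.uncurry k)) (s : I) :
    Continuous (k s) :=
  hcont.comp (Continuous.prodMk_right s)

/-- Sections of the kernel are pointwise limits of averages of sections, which are in the range of
the integral operator; a finite-dimensional range is closed. -/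
theorem section_mem_kernelRange (hcont : Continuous (Function.uncurry k))
    [FiniteDimensional ℝ (kernelRange k)] (t : I) : (fun s => k s t) ∈ kernelRange k := by
  have hclosed : IsClosed (kernelRange k : Set (I → ℝ)) := Submodule.closed_of_finiteDimensional _
  have hA : ∀ n : ℕ, ∃ a b : I, a < b ∧ Set.Ioo a b ⊆ Metric.ball t (1 / ((n : ℝ) + 1)) :=
    fun n => Metric.isOpen_ball.exists_Ioo_subset ⟨t, Metric.mem_ball_self (by positivity)⟩
  choose a b hab hsub using hA
  let f : ℕ → I → ℝ := fun n =>
    (Set.Ioo (a n) (b n)).indicator fun _ => ((b n : ℝ) - a n)⁻¹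
  have hmem : ∀ n, (fun s => ∫ t', k s t' * f n t') ∈ kernelRange k := fun n =>
    Submodule.subset_span ⟨f n, memLp_indicator_const _ measurableSet_Ioo _ (Or.inr (by simp)),
      rfl⟩
  refine hclosed.mem_of_tendsto (b := atTop) (f := fun n s => ∫ t', k s t' * f n t') ?_
    (Eventually.of_forall hmem)
  rw [tendsto_pi_nhds]
  intro s
  rw [Metric.tendsto_atTop]
  intro e he
  obtain ⟨δ, hδ, hclose⟩ := Metric.continuous_iff.1 (continuous_section hcont s) t (e / 2)
    (by positivity)
  obtain ⟨N, hN⟩ := exists_nat_one_div_lt hδ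
  refine ⟨N, fun n hn => ?_⟩
  have hpos : 0 < (b n : ℝ) - a n := sub_pos.2 (hab n)
  have hvol : (volume (Set.Ioo (a n) (b n))).toReal = (b n : ℝ) - a n := by
    rw [unitInterval.volume_Ioo, ENNReal.toReal_ofReal hpos.le]
  have hint : ∀ φ : I → ℝ, Continuous φ → IntegrableOn φ (Set.Ioo (a n) (b n)) := fun φ hφ =>
    (hφ.integrable_of_hasCompactSupport (HasCompactSupport.of_compactSpace φ)).integrableOn
  have e1 : ∫ t', k s t' * f n t' =
      (∫ t' in Set.Ioo (a n) (b n), k s t') * ((b n : ℝ) - a n)⁻¹ := by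
    rw [← integral_mul_const, ← integral_indicator measurableSet_Ioo]
    congr 1
    ext t'
    by_cases ht : t' ∈ Set.Ioo (a n) (b n) <;> simp [f, ht]
  have e2 : (∫ t', k s t' * f n t') - k s t =
      (∫ t' in Set.Ioo (a n) (b n), (k s t' - k s t)) * ((b n : ℝ) - a n)⁻¹ := by
    rw [e1, integral_sub (hint _ (continuous_section hcont s)) (hint _ continuous_const)]
    simp only [integral_const, Measure.real, Measure.restrict_apply_univ, hvol, smul_eq_mul]
    field_simp
  have e3 : ‖∫ t' in Set.Ioo (a n) (b n), (k s t' - k s t)‖ ≤ e / 2 * ((b n : ℝ) - a n) := by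
    rw [← hvol]
    refine norm_setIntegral_le_of_norm_le_const (by simp) fun t' ht' => ?_
    have h1 := hsub n ht'
    have h2 : (1 : ℝ) / ((n : ℝ) + 1) ≤ 1 / ((N : ℝ) + 1) := by gcongr
    exact (hclose t' (lt_of_lt_of_le h1 (h2.trans hN.le))).le
  rw [Real.dist_eq, e2, abs_mul, abs_of_pos (inv_pos.2 hpos)]
  calc _ ≤ e / 2 * ((b n : ℝ) - a n) * ((b n : ℝ) - a n)⁻¹ := by gcongr; exact e3
    _ = e / 2 := mul_inv_cancel_right₀ hpos.ne' _
    _ < e := by linarith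

/-- The columns are restrictions of sections of the kernel to finitely many points. -/
theorem rank_le_of_kernelRank_eq (hcont : Continuous (Function.uncurry k)) {q : ℕ}
    (hq : kernelRank k = q) {m n : Type*} [Fintype m] [Fintype n] (u : m → I) (w : n → I) :
    (Matrix.of fun i j => k (u i) (w j)).rank ≤ q := by
  have hrank : Module.rank ℝ (kernelRange k) = q := by
    rwa [kernelRank, Cardinal.toENat_eq_natCast] at hq
  have : FiniteDimensional ℝ (kernelRange k) := Module.finite_of_rank_eq_nat hrank
  have hfin : Module.finrank ℝ (kernelRange k) = q := Module.finrank_eq_of_rank_eq hrank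
  rw [rank_eq_finrank_span_cols, ← hfin]
  refine (Submodule.finrank_mono ?_).trans
    (Submodule.finrank_map_le (LinearMap.funLeft ℝ ℝ u) (kernelRange k))
  rw [Submodule.span_le]
  rintro _ ⟨j, rfl⟩
  exact ⟨fun s => k s (w j), section_mem_kernelRange hcont (w j), rfl⟩

theorem rank_lt_of_det_eq_zero {m : ℕ} {A : Matrix (Fin (m + 1)) (Fin (m + 1)) ℝ}
    (h : A.det = 0) : A.rank ≤ m := by
  obtain ⟨v, hv, hAv⟩ := exists_mulVec_eq_zero_iff.2 h
  have h1 := LinearMap.finrank_range_add_finrank_ker A.mulVecLin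
  have h2 : 0 < Module.finrank ℝ (LinearMap.ker A.mulVecLin) := by
    rw [Module.finrank_pos_iff_exists_ne_zero]
    exact ⟨⟨v, hAv⟩, fun h0 => hv (congrArg Subtype.val h0)⟩
  rw [Module.finrank_fin_fun] at h1
  rw [Matrix.rank]
  omega

/-- If an `m × m` minor is nonzero but all bordered minors vanish, the kernel is a combination of
`m` of its sections, so its rank is at most `m`. -/
theorem kernelRank_le_of_maximal_minor (hcont : Continuous (Function.uncurry k)) {m : ℕ}
    (hm : HasKernelMinor k m) (hm' : ¬HasKernelMinor k (m + 1)) : kernelRank k ≤ m := by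
  obtain ⟨u, w, hdet⟩ := hm
  set N := (Matrix.of fun i j => k (u i) (w j)) with hN
  have hk : ∀ s t, k s t = ∑ i, (∑ j, k s (w j) * N⁻¹ j i) * k (u i) t := by
    intro s t
    let Θ : Matrix (Fin (m + 1)) (Fin (m + 1)) ℝ :=
      Matrix.of fun i j => k ((Fin.cons s u : Fin (m + 1) → I) i) ((Fin.cons t w : Fin (m + 1) → I) j)
    have hΘ : Θ.det = 0 := by
      by_contra hne
      exact hm' ⟨_, _, hne⟩
    have hsub : Θ.submatrix Fin.succ Fin.succ = N := by ext i j; simp [Θ, hN]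
    have := submatrix_eq_skeleton (Θ := Θ) (Rw := Fin.succ) (Cl := Fin.succ)
      (by rw [hsub]; exact hdet.isUnit) (by simpa using rank_lt_of_det_eq_zero hΘ)
      (fun _ : Unit => 0) (fun _ : Unit => 0)
    have h2 := congrFun (congrFun this ()) ()
    rw [hsub] at h2
    simpa [Matrix.mul_apply, Θ] using h2
  have hle : kernelRange k ≤ Submodule.span ℝ (Set.range fun j : Fin m => fun s => k s (w j)) := by
    rw [kernelRange, Submodule.span_le]
    rintro _ ⟨f, hf, rfl⟩
    have hfi : Integrable f := hf.integrable (by norm_num)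
    have hint : ∀ s, Integrable fun t => k s t * f t := fun s => by
      obtain ⟨c, hc⟩ := isCompact_univ.exists_bound_of_continuousOn
        (continuous_section hcont s).continuousOn
      exact hfi.bdd_mul (c := c) (continuous_section hcont s).aestronglyMeasurable
        (Eventually.of_forall fun t => hc t (Set.mem_univ t))
    have hfun : (fun s => ∫ t, k s t * f t) =
        ∑ j, (∑ i, N⁻¹ j i * ∫ t, k (u i) t * f t) • fun s => k s (w j) := by
      ext s
      have h1 : ∀ t, k s t * f t = ∑ i, (∑ j, k s (w j) * N⁻¹ j i) * (k (u i) t * f t) := by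
        intro t
        rw [hk s t, Finset.sum_mul]
        exact Finset.sum_congr rfl fun i _ => by ring
      simp_rw [h1]
      rw [integral_finsetSum _ fun i _ => (hint (u i)).const_mul _]
      simp only [integral_const_mul]
      simp only [Finset.sum_apply, Pi.smul_apply, smul_eq_mul,
        Finset.sum_mul]
      rw [Finset.sum_comm]
      exact Finset.sum_congr rfl fun j _ => Finset.sum_congr rfl fun i _ => by ring
    rw [hfun]
    exact Submodule.sum_mem _ fun j _ =>
      Submodule.smul_mem _ _ (Submodule.subset_span ⟨j, rfl⟩)
  rw [kernelRank, Cardinal.toENat_le_natCast]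
  have h3 := (Submodule.rank_mono hle).trans (rank_span_le _)
  refine h3.trans (Cardinal.mk_range_le.trans (by simp))

theorem hasKernelMinor_of_le_kernelRank (hcont : Continuous (Function.uncurry k)) {r : ℕ}
    (hr : (r : ℕ∞) ≤ kernelRank k) : HasKernelMinor k r := by
  induction r with
  | zero => exact ⟨Fin.elim0, Fin.elim0, by simp⟩
  | succ m ih =>
    by_contra hcon
    have h1 := ih (le_trans (by exact_mod_cast Nat.le_succ m) hr)
    have h2 := hr.trans (kernelRank_le_of_maximal_minor hcont h1 hcon)
    exact absurd (by exact_mod_cast h2 : m + 1 ≤ m) (by omega)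

/-! ### Off-diagonal minors on regular grids -/

theorem exists_near_nodes {L M : ℕ} {t : Fin L → I} (ht : RegularGrid t) (p : I) {δ : ℝ}
    (hδ : 0 < δ) (hM : 1 ≤ M) (hML : M ≤ L) (hL : M / δ < L) :
    M ≤ (Finset.univ.filter fun j => dist (t j) p < δ).card := by
  have hL0 : (0 : ℝ) < L := by exact_mod_cast (by omega : 0 < L)
  -- the `M` consecutive nodes starting at the cell of `p`, moved to the left if they exceed the grid
  obtain ⟨j₀, hj₀, hlo, hhi⟩ : ∃ j₀ : ℕ, j₀ + M ≤ L ∧ (p : ℝ) * L ≤ j₀ + M ∧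
      (j₀ : ℝ) ≤ p * L := by
    have hp0 : 0 ≤ (p : ℝ) * L := mul_nonneg p.2.1 hL0.le
    have hpL : (p : ℝ) * L ≤ L := by nlinarith [p.2.2]
    rcases le_or_gt (⌊(p : ℝ) * L⌋₊ + M) L with h | h
    · refine ⟨_, h, ?_, Nat.floor_le hp0⟩
      have h1 := Nat.lt_floor_add_one ((p : ℝ) * L)
      have h2 : (1 : ℝ) ≤ M := by exact_mod_cast hM
      linarith
    · refine ⟨L - M, by omega, ?_, ?_⟩
      · rw [Nat.cast_sub hML]; linarith
      · have h1 : L - M ≤ ⌊(p : ℝ) * L⌋₊ := by omega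
        exact le_trans (by exact_mod_cast h1) (Nat.floor_le hp0)
  let e : Fin M → Fin L := fun a => ⟨j₀ + a, by have := a.2; omega⟩
  have he : Function.Injective e := fun a b hab => by
    have := congrArg Fin.val hab
    simp only [e] at this
    exact Fin.ext (by omega)
  calc M = (Finset.univ.image e).card := by rw [Finset.card_image_of_injective _ he]; simp
    _ ≤ _ := by
      refine Finset.card_le_card fun j hj => ?_
      obtain ⟨a, -, rfl⟩ := Finset.mem_image.1 hj
      rw [Finset.mem_filter]
      refine ⟨Finset.mem_univ _, ?_⟩
      obtain ⟨h1, h2⟩ := ht (e a)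
      simp only [e] at h1 h2 ⊢
      rw [div_le_iff₀ hL0] at h1
      rw [lt_div_iff₀ hL0] at h2
      push_cast at h1 h2
      have ha : (a : ℝ) + 1 ≤ M := by exact_mod_cast a.2
      have ha0 : (0 : ℝ) ≤ (a : ℕ) := Nat.cast_nonneg _
      rw [div_lt_iff₀ hδ] at hL
      rw [Subtype.dist_eq, Real.dist_eq, abs_lt]
      constructor <;> nlinarith

theorem exists_open_minor (hcont : Continuous (Function.uncurry k)) {r : ℕ}
    (h : HasKernelMinor k r) : ∃ u w : Fin r → I, ∃ δ > 0, ∀ x y : Fin r → I,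
      (∀ a, dist (x a) (u a) < δ) → (∀ a, dist (y a) (w a) < δ) →
        IsUnit (Matrix.of fun i j => k (x i) (y j)).det := by
  obtain ⟨u, w, hdet⟩ := h
  have hc : Continuous fun z : (Fin r → I) × (Fin r → I) =>
      (Matrix.of fun i j => k (z.1 i) (z.2 j)).det := by
    refine Continuous.matrix_det ?_
    refine continuous_pi fun i => continuous_pi fun j => ?_
    exact hcont.comp (by fun_prop : Continuous fun z : (Fin r → I) × (Fin r → I) =>
      (z.1 i, z.2 j))
  obtain ⟨δ, hδ, hball⟩ := Metric.isOpen_iff.1 (isOpen_ne.preimage hc) (u, w) hdet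
  refine ⟨u, w, δ, hδ, fun x y hx hy => ?_⟩
  refine IsUnit.mk0 _ (hball (a := (x, y)) ?_)
  rw [Metric.mem_ball, Prod.dist_eq, max_lt_iff]
  exact ⟨(dist_pi_lt_iff hδ).2 hx, (dist_pi_lt_iff hδ).2 hy⟩

/-- On fine regular grids a nonvanishing minor of the kernel is reproduced by an off-diagonal block
avoiding any prescribed index: each of the `2 r` neighbourhoods contains enough nodes for a
system of distinct representatives. -/
theorem exists_grid_minor (hcont : Continuous (Function.uncurry k)) {r : ℕ}
    (h : HasKernelMinor k r) : ∃ L₀ : ℕ, ∀ L, L₀ < L → ∀ t : Fin L → I, RegularGrid t →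
      ∀ i, HasOffDiagMinor (KX k t) r i := by
  obtain ⟨u, w, δ, hδ, hdet⟩ := exists_open_minor hcont h
  refine ⟨2 * r + 1 + ⌈((2 * r + 1 : ℕ) : ℝ) / δ⌉₊, fun L hL t ht i => ?_⟩
  have hnear : ∀ p : I, 2 * r + 1 ≤ (Finset.univ.filter fun j => dist (t j) p < δ).card := by
    intro p
    refine exists_near_nodes ht p hδ (by omega) (by omega) ?_
    refine lt_of_le_of_lt (Nat.le_ceil _) ?_
    exact_mod_cast (by omega : ⌈((2 * r + 1 : ℕ) : ℝ) / δ⌉₊ < L)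
  let T : Fin r ⊕ Fin r → Finset (Fin L) := fun x =>
    (Finset.univ.filter fun j => dist (t j) (Sum.elim u w x) < δ).erase i
  obtain ⟨f, hf, hfT⟩ : ∃ f : Fin r ⊕ Fin r → Fin L, Function.Injective f ∧ ∀ x, f x ∈ T x := by
    refine (Finset.all_card_le_biUnion_card_iff_exists_injective T).1 fun S => ?_
    rcases S.eq_empty_or_nonempty with rfl | ⟨x, hx⟩
    · simp
    · calc S.card ≤ Fintype.card (Fin r ⊕ Fin r) := Finset.card_le_univ S
        _ = 2 * r := by simp; ring
        _ ≤ (T x).card := by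
          have h1 := hnear (Sum.elim u w x)
          have h2 := Finset.pred_card_le_card_erase (a := i)
            (s := Finset.univ.filter fun j => dist (t j) (Sum.elim u w x) < δ)
          simp only [T]
          omega
        _ ≤ _ := Finset.card_le_card (Finset.subset_biUnion_of_mem T hx)
  have hT : ∀ x, f x ≠ i ∧ dist (t (f x)) (Sum.elim u w x) < δ := fun x => by
    have := hfT x
    simp only [T, Finset.mem_erase, Finset.mem_filter] at this
    exact ⟨this.1, this.2.2⟩
  refine ⟨fun a => f (Sum.inl a), fun a => f (Sum.inr a), fun a b => ?_, fun a => (hT _).1,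
    fun a => (hT _).1, ?_⟩
  · exact hf.ne (by simp)
  · exact hdet (fun a => t (f (Sum.inl a))) (fun a => t (f (Sum.inr a)))
      (fun a => (hT (Sum.inl a)).2) (fun a => (hT (Sum.inr a)).2)

/-- One grid size serves all block sizes up to `d + 1`. -/
theorem exists_grid_minors (hcont : Continuous (Function.uncurry k)) (d : ℕ) :
    ∃ L₀ : ℕ, d ≤ L₀ ∧ ∀ L, L₀ < L → ∀ t : Fin L → I, RegularGrid t → ∀ r ≤ d + 1,
      (r : ℕ∞) ≤ kernelRank k → ∀ i, HasOffDiagMinor (KX k t) r i := by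
  have hr : ∀ r : ℕ, ∃ L₀ : ℕ, (r : ℕ∞) ≤ kernelRank k → ∀ L, L₀ < L → ∀ t : Fin L → I,
      RegularGrid t → ∀ i, HasOffDiagMinor (KX k t) r i := by
    intro r
    by_cases h : (r : ℕ∞) ≤ kernelRank k
    · obtain ⟨L₀, hL₀⟩ := exists_grid_minor hcont (hasKernelMinor_of_le_kernelRank hcont h)
      exact ⟨L₀, fun _ => hL₀⟩
    · exact ⟨0, fun h' => absurd h' h⟩
  choose L₀ hL₀ using hr
  refine ⟨d + ∑ r ∈ Finset.range (d + 2), L₀ r, by omega, fun L hL t ht r hrd hrk =>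
    hL₀ r hrk L ?_ t ht⟩
  have := Finset.single_le_sum (f := L₀) (fun _ _ => Nat.zero_le _)
    (Finset.mem_range.2 (by omega : r < d + 2))
  omega

theorem mask_KW_sub {L : ℕ} (k : I → I → ℝ) (t : Fin L → I) (v : Fin L → ℝ)
    (Θ : Matrix (Fin L) (Fin L) ℝ) :
    offDiag L ⊙ (KW k t v - Θ) = offDiag L ⊙ (KX k t - Θ) := by
  ext i j
  by_cases h : i = j <;> simp [offDiag, KW, h]

theorem isCriticalGridSize_of_minors (hcont : Continuous (Function.uncurry k)) {d L₀ : ℕ}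
    (h : ∀ L, L₀ < L → ∀ t : Fin L → I, RegularGrid t → ∀ r ≤ d + 1,
      (r : ℕ∞) ≤ kernelRank k → ∀ i, HasOffDiagMinor (KX k t) r i) :
    IsCriticalGridSize k d L₀ := by
  intro L hL t ht v _ q _ hqd
  refine ⟨fun hq => ?_, fun hq => ?_⟩
  · have hK : (KX k t).rank ≤ q := rank_le_of_kernelRank_eq hcont hq t t
    refine ⟨hK, fun Θ hΘ => ?_⟩
    rw [offDiagLoss_eq, mask_KW_sub, mask_sub, sq_eq_zero_iff, norm_eq_zero, sub_eq_zero]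
    refine ⟨fun h0 => eq_of_mask_eq hK hΘ (h L hL t ht q (by omega) hq.ge) h0.symm, ?_⟩
    rintro rfl; rfl
  · have hq' : ((q + 1 : ℕ) : ℕ∞) ≤ kernelRank k := by
      push_cast; exact Order.add_one_le_of_lt hq
    obtain ⟨c, hc, hle⟩ := exists_pos_le_mask (h L hL t ht (q + 1) (by omega) hq' ⟨0, by omega⟩)
    refine ⟨c ^ 2, by positivity, fun Θ hΘ => ?_⟩
    rw [offDiagLoss_eq, mask_KW_sub]
    have := hle Θ hΘ
    rw [mask_sub, norm_sub_rev, ← mask_sub] at this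
    gcongr

end Kernel

/-! ### The multivariate central limit theorem -/

section CLT

variable {Ω ι : Type*} [MeasurableSpace Ω] [Fintype ι] {P : Measure Ω}
  [IsProbabilityMeasure P]

/-- The matrix of covariances of the coordinates of a random vector. -/
noncomputable def covarianceMatrix (Y : Ω → ι → ℝ) (P : Measure Ω) : Matrix ι ι ℝ :=
  Matrix.of fun i j => cov[fun ω => Y ω i, fun ω => Y ω j; P]

theorem variance_dotProduct {Y : Ω → ι → ℝ} (hY : ∀ i, MemLp (fun ω => Y ω i) 2 P) (x : ι → ℝ) :
    Var[fun ω => x ⬝ᵥ Y ω; P] = x ⬝ᵥ covarianceMatrix Y P *ᵥ x := by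
  have h1 : (fun ω => x ⬝ᵥ Y ω) = fun ω => ∑ i, x i * Y ω i := rfl
  rw [h1, variance_fun_sum fun i => (hY i).const_mul (x i)]
  simp only [covariance_const_mul_left, covariance_const_mul_right, dotProduct, mulVec,
    covarianceMatrix, of_apply, Finset.mul_sum]
  exact Finset.sum_congr rfl fun i _ => Finset.sum_congr rfl fun j _ => by ring

theorem posSemidef_covarianceMatrix {Y : Ω → ι → ℝ} (hY : ∀ i, MemLp (fun ω => Y ω i) 2 P) :
    (covarianceMatrix Y P).PosSemidef := by
  refine PosSemidef.of_dotProduct_mulVec_nonneg ?_ fun x => ?_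
  · ext i j
    simp [covarianceMatrix, covariance_comm]
  · rw [star_trivial, ← variance_dotProduct hY]
    exact variance_nonneg _ _

/-- The **multivariate central limit theorem** for centred vectors, from the one-dimensional one
by the Cramér–Wold device. -/
theorem tendstoInDistribution_vector_clt [DecidableEq ι] {Y : ℕ → Ω → ι → ℝ} (hind : iIndepFun Y P)
    (hid : ∀ i, IdentDistrib (Y i) (Y 0) P P) (hmem : ∀ a, MemLp (fun ω => Y 0 ω a) 2 P)
    (hmean : ∀ a, ∫ ω, Y 0 ω a ∂P = 0) :
    TendstoInDistribution (fun (n : ℕ) ω => (√n)⁻¹ • ∑ k ∈ Finset.range n, Y k ω) atTop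
      (fun x : EuclideanSpace ℝ ι => WithLp.ofLp x) (fun _ => P)
      (multivariateGaussian 0 (covarianceMatrix (Y 0) P)) := by
  set S := covarianceMatrix (Y 0) P with hS
  have mY : ∀ i, AEMeasurable (Y i) P := fun i => (hid i).aemeasurable_fst
  have mSum : ∀ n : ℕ, AEMeasurable (fun ω => (√(n : ℝ))⁻¹ • ∑ k ∈ Finset.range n, Y k ω) P :=
    fun n => (Finset.aemeasurable_fun_sum _ fun k _ => mY k).fun_const_smul _
  have mLp : ∀ n : ℕ, AEMeasurable
      (fun ω => WithLp.toLp 2 ((√(n : ℝ))⁻¹ • ∑ k ∈ Finset.range n, Y k ω)) P := fun n =>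
    (by fun_prop : Measurable (WithLp.toLp 2 : (ι → ℝ) → EuclideanSpace ℝ ι)).comp_aemeasurable
      (mSum n)
  suffices h : TendstoInDistribution
      (fun (n : ℕ) ω => WithLp.toLp 2 ((√(n : ℝ))⁻¹ • ∑ k ∈ Finset.range n, Y k ω)) atTop
      (fun x : EuclideanSpace ℝ ι => x) (fun _ => P) (multivariateGaussian 0 S) by
    exact h.continuous_comp (g := fun x : EuclideanSpace ℝ ι => WithLp.ofLp x) (by fun_prop)
  refine ⟨mLp, aemeasurable_id, ?_⟩
  refine ProbabilityMeasure.tendsto_iff_tendsto_charFun.2 fun t => ?_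
  set y : ι → ℝ := WithLp.ofLp t with hy
  have mdot : Measurable fun v : ι → ℝ => y ⬝ᵥ v := by
    unfold dotProduct; fun_prop
  -- the one-dimensional theorem in the direction `t`
  have h1 := tendstoInDistribution_inv_sqrt_mul_sum_sub (P := P) (X := fun k ω => y ⬝ᵥ Y k ω)
    (Y := id) (P' := gaussianReal 0 (Var[fun ω => y ⬝ᵥ Y 0 ω; P]).toNNReal)
    ⟨aemeasurable_id, Measure.map_id⟩
    (memLp_finsetSum _ fun i _ => (hmem i).const_mul (y i))
    (hind.comp (fun _ v => y ⬝ᵥ v) fun _ => mdot) (fun i => (hid i).comp mdot)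
  have hmean0 : ∫ ω, y ⬝ᵥ Y 0 ω ∂P = 0 := by
    simp only [dotProduct]
    rw [integral_finsetSum _ fun i _ => ((hmem i).integrable (by norm_num)).const_mul _]
    simp [integral_const_mul, hmean]
  have h2 := ProbabilityMeasure.tendsto_iff_tendsto_charFun.1 h1.tendsto 1
  simp only [ProbabilityMeasure.coe_mk, Measure.map_id, charFun_gaussianReal] at h2
  have hlim : charFun (multivariateGaussian 0 S) t =
      Complex.exp (1 * (0 : ℝ) * Complex.I -
        (Var[fun ω => y ⬝ᵥ Y 0 ω; P]).toNNReal * 1 ^ 2 / 2) := by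
    rw [charFun_multivariateGaussian (posSemidef_covarianceMatrix hmem),
      Real.coe_toNNReal _ (variance_nonneg _ _), variance_dotProduct hmem]
    simp [hy]
  have hid' : (multivariateGaussian 0 S).map (fun x : EuclideanSpace ℝ ι => x) =
      multivariateGaussian 0 S := Measure.map_id
  simp only [ProbabilityMeasure.coe_mk, hid', hlim]
  refine (h2.congr fun n => ?_).trans_eq ?_
  · rw [charFun_apply, charFun_apply, integral_map (h1.forall_aemeasurable n) (by fun_prop),
      integral_map (mLp n) (by fun_prop)]
    congr 1
    ext ω
    have hinner : inner ℝ (WithLp.toLp 2 ((√(n : ℝ))⁻¹ • ∑ k ∈ Finset.range n, Y k ω)) t =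
        (√(n : ℝ))⁻¹ * ∑ k ∈ Finset.range n, y ⬝ᵥ Y k ω := by
      rw [← dotProduct_sum, ← smul_eq_mul, ← dotProduct_smul]
      simp [PiLp.inner_apply, dotProduct, hy]
    rw [hinner, hmean0]
    simp
  · simp

end CLT

/-! ### Independent and identically distributed measurements -/

section Independence

variable {Ω : Type*} [MeasurableSpace Ω] {P : Measure Ω}

/-- Grouping an independent family indexed by pairs according to the first index gives
independent blocks. -/
theorem iIndepFun_blocks {ι κ E : Type*} [MeasurableSpace E] {F : ι → κ → Ω → E}
    (hm : ∀ i j, Measurable (F i j)) (h : iIndepFun (fun p : ι × κ => F p.1 p.2) P) :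
    iIndepFun (fun i ω j => F i j ω) P := by
  have hP := h.isProbabilityMeasure
  have : ∀ i j, IsProbabilityMeasure (P.map (F i j)) := fun i j =>
    Measure.isProbabilityMeasure_map (hm i j).aemeasurable
  have hrow : ∀ i, iIndepFun (F i) P := fun i =>
    h.precomp (g := fun j => (i, j)) fun a b hab => (Prod.mk.inj hab).2
  have mblock : ∀ i, Measurable fun ω j => F i j ω := fun i => measurable_pi_lambda _ (hm i)
  rw [iIndepFun_iff_map_fun_eq_infinitePi_map mblock]
  simp_rw [fun i => (iIndepFun_iff_map_fun_eq_infinitePi_map (hm i)).1 (hrow i)]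
  have mpair : Measurable fun ω (p : ι × κ) => F p.1 p.2 ω :=
    measurable_pi_lambda _ fun p => hm p.1 p.2
  rw [← Measure.infinitePi_map_curry (fun i j => P.map (F i j)),
    ← (iIndepFun_iff_map_fun_eq_infinitePi_map fun p : ι × κ => hm p.1 p.2).1 h,
    Measure.map_map (by fun_prop) mpair]
  rfl

theorem iIndepFun_bool {E : Bool → Type*} [∀ b, MeasurableSpace (E b)] {f : ∀ b, Ω → E b}
    [IsProbabilityMeasure P] (h : IndepFun (f true) (f false) P) : iIndepFun f P := by
  rw [iIndepFun_iff_measure_inter_preimage_eq_mul]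
  intro S sets hsets
  by_cases h1 : true ∈ S <;> by_cases h2 : false ∈ S
  · have hS : S = {true, false} := by ext b; cases b <;> simp [h1, h2]
    subst hS
    rw [Finset.set_biInter_insert, Finset.set_biInter_singleton, Finset.prod_pair (by decide)]
    exact h.measure_inter_preimage_eq_mul _ _ (hsets true h1) (hsets false h2)
  · have hS : S = {true} := by ext b; cases b <;> simp [h1, h2]
    subst hS; simp
  · have hS : S = {false} := by ext b; cases b <;> simp [h1, h2]
    subst hS; simp
  · have hS : S = ∅ := by ext b; cases b <;> simp [h1, h2]
    subst hS; simp

variable {L : ℕ} {k : I → I → ℝ} {v : Fin L → ℝ} {X : ℕ → I → Ω → ℝ} {ε : ℕ → Fin L → Ω → ℝ}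

/-- The two sources of randomness of the `i`-th measurement: the grid values of the process and the
errors. -/
def sources (t : Fin L → I) (X : ℕ → I → Ω → ℝ) (ε : ℕ → Fin L → Ω → ℝ) (b : Bool) (i : ℕ)
    (ω : Ω) : Fin L → ℝ :=
  bif b then fun j => X i (t j) ω else fun j => ε i j ω

namespace NoisySample

theorem measurable_sources (h : NoisySample P k v X ε) (t : Fin L → I) (b : Bool) (i : ℕ) :
    Measurable (sources t X ε b i) := by
  cases b
  · exact measurable_pi_lambda _ fun j => h.measurable_eps i j
  · exact measurable_pi_lambda _ fun j => h.measurable_X i (t j)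

theorem iIndepFun_sources [IsProbabilityMeasure P] (h : NoisySample P k v X ε) (t : Fin L → I) :
    iIndepFun (fun p : Bool × ℕ => sources t X ε p.1 p.2) P := by
  refine iIndepFun_uncurry' (h.measurable_sources t) (iIndepFun_bool ?_) fun b => ?_
  · exact h.indep_X_eps.comp
      (φ := fun (x : ℕ × I → ℝ) (i : ℕ) (j : Fin L) => x (i, t j))
      (ψ := fun (x : ℕ × Fin L → ℝ) (i : ℕ) (j : Fin L) => x (i, j)) (by fun_prop) (by fun_prop)
  · cases b
    · exact iIndepFun_blocks h.measurable_eps h.indep_eps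
    · exact h.indep_X.comp (fun _ (x : I → ℝ) (j : Fin L) => x (t j)) fun _ => by fun_prop

theorem identDistrib_sources (h : NoisySample P k v X ε) (t : Fin L → I) (b : Bool) (i : ℕ) :
    IdentDistrib (sources t X ε b i) (sources t X ε b 0) P P := by
  cases b
  · have hrow : ∀ i, iIndepFun (ε i) P := fun i =>
      h.indep_eps.precomp (g := fun j => (i, j)) fun a b hab => (Prod.mk.inj hab).2
    exact IdentDistrib.pi (h.ident_eps i) (hrow i) (hrow 0)
  · exact (h.ident_X i).comp (u := fun (x : I → ℝ) (j : Fin L) => x (t j)) (by fun_prop)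

theorem iIndepFun_measurement [IsProbabilityMeasure P] (h : NoisySample P k v X ε) (t : Fin L → I) :
    iIndepFun (measurement t X ε) P := by
  have h1 : iIndepFun (fun p : ℕ × Bool => sources t X ε p.2 p.1) P :=
    (h.iIndepFun_sources t).precomp (g := Prod.swap) Prod.swap_injective
  exact (iIndepFun_blocks (F := fun i b => sources t X ε b i)
    (fun i b => h.measurable_sources t b i) h1).comp
      (fun _ (s : Bool → Fin L → ℝ) => s true + s false) fun _ => by fun_prop

theorem identDistrib_measurement [IsProbabilityMeasure P] (h : NoisySample P k v X ε) (t : Fin L → I) (i : ℕ) :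
    IdentDistrib (measurement t X ε i) (measurement t X ε 0) P P := by
  have hrow : ∀ i, iIndepFun (fun b => sources t X ε b i) P := fun i =>
    (h.iIndepFun_sources t).precomp (g := fun b => (b, i)) fun a b hab => (Prod.mk.inj hab).1
  exact (IdentDistrib.pi (fun b => h.identDistrib_sources t b i) (hrow i) (hrow 0)).comp
    (u := fun s : Bool → Fin L → ℝ => s true + s false) (by fun_prop)

theorem measurable_measurement (h : NoisySample P k v X ε) (t : Fin L → I) (i : ℕ) :
    Measurable (measurement t X ε i) :=
  measurable_pi_lambda _ fun j => (h.measurable_X i (t j)).add (h.measurable_eps i j)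

theorem memLp_measurement (h : NoisySample P k v X ε) (t : Fin L → I) (j : Fin L) :
    MemLp (fun ω => measurement t X ε 0 ω j) 2 P :=
  (h.memLp_X (t j)).add (h.memLp_eps j)

/-- The second moments of a measurement vector form `K_{W,L}`. -/
theorem integral_measurement_mul (h : NoisySample P k v X ε) (t : Fin L → I) (i j : Fin L) :
    ∫ ω, measurement t X ε 0 ω i * measurement t X ε 0 ω j ∂P = KW k t v i j := by
  have hXE : ∀ a b, ∫ ω, X 0 (t a) ω * ε 0 b ω ∂P = 0 := fun a b => by
    have hi : IndepFun (X 0 (t a)) (ε 0 b) P := h.indep_X_eps.comp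
      (φ := fun x : ℕ × I → ℝ => x (0, t a)) (ψ := fun x : ℕ × Fin L → ℝ => x (0, b))
      (by fun_prop) (by fun_prop)
    rw [hi.integral_fun_mul_eq_mul_integral (h.measurable_X _ _).aestronglyMeasurable
      (h.measurable_eps _ _).aestronglyMeasurable, h.mean_X, zero_mul]
  have hEE : ∫ ω, ε 0 i ω * ε 0 j ω ∂P = Matrix.diagonal v i j := by
    by_cases hij : i = j
    · subst hij
      rw [diagonal_apply_eq, ← h.var_eps i]
      simp_rw [pow_two]
    · have hi : IndepFun (ε 0 i) (ε 0 j) P :=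
        h.indep_eps.indepFun (i := (0, i)) (j := (0, j)) (by simpa using hij)
      rw [hi.integral_fun_mul_eq_mul_integral (h.measurable_eps _ _).aestronglyMeasurable
        (h.measurable_eps _ _).aestronglyMeasurable, h.mean_eps, zero_mul,
        diagonal_apply_ne _ hij]
  have i1 : Integrable (fun ω => X 0 (t i) ω * X 0 (t j) ω) P :=
    (h.memLp_X _).integrable_mul (h.memLp_X _)
  have i2 : Integrable (fun ω => X 0 (t i) ω * ε 0 j ω) P :=
    (h.memLp_X _).integrable_mul (h.memLp_eps _)
  have i3 : Integrable (fun ω => X 0 (t j) ω * ε 0 i ω) P :=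
    (h.memLp_X _).integrable_mul (h.memLp_eps _)
  have i4 : Integrable (fun ω => ε 0 i ω * ε 0 j ω) P :=
    (h.memLp_eps _).integrable_mul (h.memLp_eps _)
  have e1 : ∀ ω, measurement t X ε 0 ω i * measurement t X ε 0 ω j =
      (X 0 (t i) ω * X 0 (t j) ω + X 0 (t i) ω * ε 0 j ω) +
        (X 0 (t j) ω * ε 0 i ω + ε 0 i ω * ε 0 j ω) := fun ω => by
    simp only [measurement]; ring
  simp_rw [e1]
  have i12 : Integrable (fun ω => X 0 (t i) ω * X 0 (t j) ω + X 0 (t i) ω * ε 0 j ω) P := i1.add i2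
  have i34 : Integrable (fun ω => X 0 (t j) ω * ε 0 i ω + ε 0 i ω * ε 0 j ω) P := i3.add i4
  rw [integral_add i12 i34, integral_add i1 i2, integral_add i3 i4, h.cov_X, hXE,
    hXE, hEE]
  simp [KW, KX]

end NoisySample

end Independence

/-! ### Remainders that vanish in probability -/

section Slutsky

variable {Ω Ω' : Type*} [MeasurableSpace Ω] [MeasurableSpace Ω'] {P : Measure Ω}
  [IsProbabilityMeasure P] {P' : Measure Ω'} [IsProbabilityMeasure P']

/-- Convergence in distribution to the constant `0` implies convergence in probability. -/
theorem tendstoInMeasure_zero_of_tendstoInDistribution {V : ℕ → Ω → ℝ}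
    (hV : TendstoInDistribution V atTop (fun _ : Ω' => (0 : ℝ)) (fun _ => P) P') :
    TendstoInMeasure P V atTop (fun _ => 0) := by
  rw [tendstoInMeasure_iff_norm]
  intro e he
  have hclosed : IsClosed {x : ℝ | e ≤ ‖x - 0‖} :=
    isClosed_le continuous_const (by fun_prop)
  have h1 := ProbabilityMeasure.limsup_measure_closed_le_of_tendsto hV.tendsto hclosed
  have h2 : ∀ n, (P.map (V n)) {x : ℝ | e ≤ ‖x - 0‖} = P {ω | e ≤ ‖V n ω - 0‖} := fun n =>
    Measure.map_apply_of_aemeasurable (hV.forall_aemeasurable n) hclosed.measurableSet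
  simp only [ProbabilityMeasure.coe_mk, h2] at h1
  have h3 : (P'.map fun _ => (0 : ℝ)) {x : ℝ | e ≤ ‖x - 0‖} = 0 := by
    rw [Measure.map_apply measurable_const hclosed.measurableSet]
    simp [not_le.2 he]
  rw [h3] at h1
  exact tendsto_of_le_liminf_of_limsup_le (by simp) h1

/-- A remainder bounded by `n^{-1/2}` times a continuous function of a sequence converging in
distribution vanishes in probability. -/
theorem tendstoInMeasure_zero_of_le {E : Type*} [TopologicalSpace E] [MeasurableSpace E]
    [BorelSpace E] {Y : ℕ → Ω → E} {Z : Ω' → E}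
    (hY : TendstoInDistribution Y atTop Z (fun _ => P) P') {g : E → ℝ} (hg : Continuous g)
    {R : ℕ → Ω → ℝ} (hR : ∀ n ω, |R n ω| ≤ (√(n : ℝ))⁻¹ * g (Y n ω)) :
    TendstoInMeasure P R atTop (fun _ => 0) := by
  have hs : Tendsto (fun n : ℕ => (√(n : ℝ))⁻¹) atTop (𝓝 0) :=
    tendsto_inv_atTop_zero.comp (Real.tendsto_sqrt_atTop.comp tendsto_natCast_atTop_atTop)
  have hconst : TendstoInMeasure P (fun (n : ℕ) (_ : Ω) => (√(n : ℝ))⁻¹) atTop (fun _ => 0) :=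
    tendstoInMeasure_of_tendsto_ae (fun n => aestronglyMeasurable_const)
      (Eventually.of_forall fun _ => hs)
  have h1 := (hY.continuous_comp hg).continuous_comp_prodMk_of_tendstoInMeasure_const
    (g := fun x : ℝ × ℝ => x.2 * x.1) (by fun_prop) hconst (fun n => aemeasurable_const)
  simp only [zero_mul] at h1
  have h2 := tendstoInMeasure_zero_of_tendstoInDistribution h1
  rw [tendstoInMeasure_iff_norm] at h2 ⊢
  intro e he
  refine tendsto_of_tendsto_of_tendsto_of_le_of_le tendsto_const_nhds (h2 e he)
    (fun _ => zero_le) fun n => measure_mono fun ω hω => ?_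
  simp only [Set.mem_ofPred_eq, sub_zero, Real.norm_eq_abs, Function.comp_apply] at hω ⊢
  exact hω.trans ((hR n ω).trans (le_abs_self _))

end Slutsky

/-! ### Regularity of the statistics -/

section Regularity

variable {L q : ℕ}

/-- The matrix with given `vec`. -/
def unvec (y : Fin L × Fin L → ℝ) : Matrix (Fin L) (Fin L) ℝ := Matrix.of fun i j => y (j, i)

theorem unvec_vec (A : Matrix (Fin L) (Fin L) ℝ) : unvec (vec A) = A := rfl

theorem continuous_limitForm (C : Matrix (Fin L) (Fin q) ℝ)
    (G : Matrix (Fin q × Fin L) (Fin q × Fin L) ℝ) :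
    Continuous fun y : Fin L × Fin L → ℝ => limitForm C G (unvec y) := by
  simp only [limitForm, frobSq, Matrix.trace, diag, Matrix.mul_apply, transpose_apply,
    hadamard_apply, dotProduct, mulVec, vec, unvec, of_apply]
  fun_prop

theorem continuous_offDiagLoss (Θ : Matrix (Fin L) (Fin L) ℝ) :
    Continuous fun y : Fin L × Fin L → ℝ => offDiagLoss (unvec y) Θ := by
  simp only [offDiagLoss, frobSq, Matrix.trace, diag, Matrix.mul_apply, transpose_apply,
    hadamard_apply, Matrix.sub_apply, unvec, of_apply]
  fun_prop

/-- As an infimum of continuous functions, the test statistic is upper semicontinuous. -/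
theorem measurable_testStat :
    Measurable fun y : Fin L × Fin L → ℝ => testStat q (unvec y) := by
  refine UpperSemicontinuous.measurable ?_
  refine upperSemicontinuous_ciInf (fun y => ⟨0, ?_⟩) fun Θ =>
    (continuous_offDiagLoss Θ.1).upperSemicontinuous
  rintro _ ⟨Θ, rfl⟩
  simp only [offDiagLoss_eq]
  positivity

theorem continuous_norm_unvec : Continuous fun y : Fin L × Fin L → ℝ => ‖unvec y‖ := by
  simp only [norm_eq_sqrt_vec, dotProduct, vec, unvec, of_apply]
  fun_prop

theorem limitForm_smul (C : Matrix (Fin L) (Fin q) ℝ)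
    (G : Matrix (Fin q × Fin L) (Fin q × Fin L) ℝ) (c : ℝ) (E : Matrix (Fin L) (Fin L) ℝ) :
    limitForm C G (c • E) = c ^ 2 * limitForm C G E := by
  rw [limitForm_eq, limitForm_eq, mask_smul, norm_smul, Matrix.smul_mul, vec_smul, mulVec_smul,
    dotProduct_smul, smul_dotProduct, mul_pow, Real.norm_eq_abs, sq_abs, smul_eq_mul, smul_eq_mul]
  ring

end Regularity

/-! ### Limit theorems for the empirical covariance -/

section Limits

variable {Ω : Type*} {L : ℕ} {k : I → I → ℝ} {t : Fin L → I} {v : Fin L → ℝ}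
  {X : ℕ → I → Ω → ℝ} {ε : ℕ → Fin L → Ω → ℝ}

theorem empCov_apply (W : ℕ → Ω → Fin L → ℝ) (n : ℕ) (ω : Ω) (i j : Fin L) :
    empCov W n ω i j = (n : ℝ)⁻¹ * ∑ m ∈ Finset.range n, W m ω i * W m ω j := by
  simp [empCov, Matrix.sum_apply, vecMulVec_apply]

theorem empCov_transpose (W : ℕ → Ω → Fin L → ℝ) (n : ℕ) (ω : Ω) :
    (empCov W n ω)ᵀ = empCov W n ω := by
  ext i j
  simp only [transpose_apply, empCov_apply, mul_comm (W _ ω i)]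

theorem KW_transpose (hk : IsCovarianceKernel k) : (KW k t v)ᵀ = KW k t v := by
  have h1 : (KX k t)ᵀ = KX k t := by
    have := (hk L t).isHermitian.eq
    rwa [conjTranspose_eq_transpose_of_trivial] at this
  rw [KW, transpose_add, h1, diagonal_transpose]

variable [MeasurableSpace Ω] {P : Measure Ω}

theorem measurable_vec_empCov (h : NoisySample P k v X ε) (n : ℕ) :
    Measurable fun ω => vec (empCov (measurement t X ε) n ω) := by
  refine measurable_pi_lambda _ fun p => ?_
  simp only [vec, empCov_apply]
  have hm : ∀ i j, Measurable fun ω => measurement t X ε i ω j := fun i j =>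
    (measurable_pi_apply j).comp (h.measurable_measurement t i)
  exact (Finset.measurable_fun_sum _ fun i _ => (hm i _).mul (hm i _)).const_mul _

variable [IsProbabilityMeasure P]

/-- The strong law of large numbers for the empirical covariance. -/
theorem ae_tendsto_norm_empCov_sub (h : NoisySample P k v X ε) :
    ∀ᵐ ω ∂P, Tendsto (fun n => ‖empCov (measurement t X ε) n ω - KW k t v‖) atTop (𝓝 0) := by
  have hentry : ∀ i j : Fin L, ∀ᵐ ω ∂P, Tendsto
      (fun n => empCov (measurement t X ε) n ω i j) atTop (𝓝 (KW k t v i j)) := by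
    intro i j
    have hm : Measurable fun w : Fin L → ℝ => w i * w j := by fun_prop
    have hslln := strong_law_ae_real (fun m ω => measurement t X ε m ω i * measurement t X ε m ω j)
      ((h.memLp_measurement t i).integrable_mul (h.memLp_measurement t j))
      (fun a b hab => ((h.iIndepFun_measurement t).comp (fun _ w => w i * w j)
        fun _ => hm).indepFun hab)
      (fun a => (h.identDistrib_measurement t a).comp hm)
    rw [h.integral_measurement_mul] at hslln
    filter_upwards [hslln] with ω hω
    simp only [empCov_apply]
    refine hω.congr fun n => ?_
    rw [div_eq_inv_mul]
  have hall := ae_all_iff.2 fun i => ae_all_iff.2 fun j => hentry i j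
  filter_upwards [hall] with ω hω
  have hsq : Tendsto (fun n => ∑ i, ∑ j, (empCov (measurement t X ε) n ω - KW k t v) i j ^ 2)
      atTop (𝓝 (∑ _i : Fin L, ∑ _j : Fin L, (0 : ℝ) ^ 2)) := by
    refine tendsto_finsetSum _ fun i _ => tendsto_finsetSum _ fun j _ => ?_
    refine Tendsto.pow ?_ 2
    simpa using (hω i j).sub_const (KW k t v i j)
  simp only [← norm_sq_eq_sum] at hsq
  have := (Real.continuous_sqrt.tendsto _).comp hsq
  simpa [Function.comp_def, Real.sqrt_sq (norm_nonneg _)] using this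

/-- Under the alternative `K̂` approaches `K_{W,L}`, which stays at a positive off-diagonal distance
from the matrices of rank at most `q`. -/
theorem tendsto_testStat_atTop (h : NoisySample P k v X ε) {q : ℕ} {i : Fin L}
    (hmin : HasOffDiagMinor (KX k t) (q + 1) i) :
    ∀ᵐ ω ∂P, Tendsto (fun n : ℕ => (n : ℝ) * testStat q (empCov (measurement t X ε) n ω))
      atTop atTop := by
  obtain ⟨c, hc, hle⟩ := exists_pos_le_mask hmin
  filter_upwards [ae_tendsto_norm_empCov_sub (t := t) h] with ω hω
  have hlim : Tendsto (fun n : ℕ => (n : ℝ) * (c / 2) ^ 2) atTop atTop :=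
    tendsto_natCast_atTop_atTop.atTop_mul_const (by positivity)
  refine tendsto_atTop_mono' _ ?_ hlim
  filter_upwards [hω.eventually (gt_mem_nhds (by positivity : (0 : ℝ) < c / 2))] with n hn
  gcongr
  refine le_testStat fun Θ hΘ => ?_
  set Khat := empCov (measurement t X ε) n ω
  have h1 : offDiag L ⊙ (Θ - KX k t) =
      offDiag L ⊙ (Khat - KW k t v) - offDiag L ⊙ (Khat - Θ) := by
    rw [← mask_sub, sub_sub_sub_cancel_left, mask_sub, mask_sub]
    congr 1
    have := mask_KW_sub k t v 0
    rw [sub_zero, sub_zero] at this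
    exact this.symm
  have h2 := hle Θ hΘ
  rw [h1] at h2
  have h3 := norm_sub_le (offDiag L ⊙ (Khat - KW k t v)) (offDiag L ⊙ (Khat - Θ))
  have h4 := norm_mask_le (Khat - KW k t v)
  have h5 : c / 2 ≤ ‖offDiag L ⊙ (Khat - Θ)‖ := by linarith
  gcongr

/-- With fourth moments, the multivariate central limit theorem applies to the entries of
`W_i W_iᵀ - K_{W,L}`. -/
theorem exists_gaussian_fluctuationLimit (h : NoisySample P k v X ε)
    (hX : ∀ j, MemLp (X 0 (t j)) 4 P) (hε : ∀ j, MemLp (ε 0 j) 4 P) :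
    ∃ (Ω' : Type) (_ : MeasurableSpace Ω') (P' : Measure Ω') (_ : IsProbabilityMeasure P')
      (Z : Ω' → Matrix (Fin L) (Fin L) ℝ),
      HasGaussianLaw (fun ω' => vec (Z ω')) P' ∧ (∀ i j, ∫ ω', Z ω' i j ∂P' = 0) ∧
      IsFluctuationLimit P P' (measurement t X ε) (KW k t v) Z := by
  set K := KW k t v with hK
  let φ : (Fin L → ℝ) → Fin L × Fin L → ℝ := fun w p => w p.2 * w p.1 - K p.2 p.1
  have hφ : Measurable φ := by fun_prop
  let Y : ℕ → Ω → Fin L × Fin L → ℝ := fun m ω => φ (measurement t X ε m ω)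
  have hW4 : ∀ j, MemLp (fun ω => measurement t X ε 0 ω j) 4 P := fun j => (hX j).add (hε j)
  have h442 : ENNReal.HolderTriple 4 4 2 := ⟨by
    rw [← ENNReal.toReal_eq_toReal_iff' (by simp) (by simp)]
    rw [ENNReal.toReal_add (by simp) (by simp)]
    norm_num⟩
  have hmem : ∀ p, MemLp (fun ω => Y 0 ω p) 2 P := fun p =>
    ((hW4 p.1).mul' (hW4 p.2)).sub (memLp_const _)
  have hint : ∀ p : Fin L × Fin L, Integrable
      (fun ω => measurement t X ε 0 ω p.2 * measurement t X ε 0 ω p.1) P := fun p =>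
    (h.memLp_measurement t _).integrable_mul (h.memLp_measurement t _)
  have hmean : ∀ p, ∫ ω, Y 0 ω p ∂P = 0 := fun p => by
    simp only [Y, φ]
    rw [integral_sub (hint p) (integrable_const _), h.integral_measurement_mul, integral_const]
    simp [hK]
  have hclt := tendstoInDistribution_vector_clt (P := P) (Y := Y)
    ((h.iIndepFun_measurement t).comp (fun _ => φ) fun _ => hφ)
    (fun i => (h.identDistrib_measurement t i).comp hφ) hmem hmean
  refine ⟨EuclideanSpace ℝ (Fin L × Fin L), inferInstance,
    multivariateGaussian 0 (covarianceMatrix (Y 0) P), inferInstance,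
    fun x => unvec (WithLp.ofLp x), ?_, fun i j => ?_, ?_⟩
  · exact IsGaussian.hasGaussianLaw_id.map_equiv (EuclideanSpace.equiv (Fin L × Fin L) ℝ)
  · let π : EuclideanSpace ℝ (Fin L × Fin L) →L[ℝ] ℝ := EuclideanSpace.proj (j, i)
    have h1 := π.integral_comp_id_comm (μ := multivariateGaussian 0 (covarianceMatrix (Y 0) P))
      IsGaussian.integrable_id
    rw [integral_id_multivariateGaussian, map_zero] at h1
    exact h1
  · refine hclt.congr (fun n => Eventually.of_forall fun ω => ?_) (Eventually.of_forall fun x => rfl)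
    ext p
    rcases Nat.eq_zero_or_pos n with rfl | hn
    · simp [vec]
    · have hn' : (0 : ℝ) < n := by exact_mod_cast hn
      have hs : √(n : ℝ) * (n : ℝ)⁻¹ = (√(n : ℝ))⁻¹ := by
        rw [← div_eq_mul_inv, Real.sqrt_div_self]
      simp only [vec, Matrix.smul_apply, Matrix.sub_apply, empCov_apply, Pi.smul_apply,
        Finset.sum_apply, smul_eq_mul, Y, φ, Finset.sum_sub_distrib, Finset.sum_const,
        Finset.card_range, nsmul_eq_mul]
      rw [← hs, mul_assoc, mul_sub (n : ℝ)⁻¹, inv_mul_cancel_left₀ hn'.ne']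

/-- The limit under an exact factorization `K_{X,L} = C Cᵀ`, by Slutsky's theorem and the
second-order expansion of the test statistic. -/
theorem tendstoInDistribution_testStat (hk : IsCovarianceKernel k) (h : NoisySample P k v X ε)
    {q : ℕ} (hL : 0 < L) (hmin : ∀ i, HasOffDiagMinor (KX k t) q i) {Ω' : Type*}
    [MeasurableSpace Ω'] {P' : Measure Ω'} [IsProbabilityMeasure P']
    {Z : Ω' → Matrix (Fin L) (Fin L) ℝ}
    (hZ : IsFluctuationLimit P P' (measurement t X ε) (KW k t v) Z)
    {C : Matrix (Fin L) (Fin q) ℝ} (hC : KX k t = C * Cᵀ)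
    {G : Matrix (Fin q × Fin L) (Fin q × Fin L) ℝ}
    (hG : hessPsi (KW k t v) C * G * hessPsi (KW k t v) C = hessPsi (KW k t v) C) :
    TendstoInDistribution
      (fun (n : ℕ) ω => (n : ℝ) * testStat q (empCov (measurement t X ε) n ω)) atTop
      (fun ω' => limitForm C G (Z ω')) (fun _ => P) P' := by
  set K := KW k t v with hK
  have hKC : offDiag L ⊙ (K - C * Cᵀ) = 0 := by
    rw [hK, mask_KW_sub, hC, sub_self, hadamard_zero]
  rw [hC] at hmin
  obtain ⟨B, hBC⟩ := exists_left_inverse (hmin ⟨0, hL⟩)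
  obtain ⟨c, hc, hexp⟩ := testStat_sub_limitForm_le hKC hG hmin hBC
  have hlim := hZ.continuous_comp (continuous_limitForm C G)
  refine tendstoInDistribution_of_tendstoInMeasure_sub _ _ hlim ?_ fun n => ?_
  · refine tendstoInMeasure_zero_of_le hZ (g := fun y => c * ‖unvec y‖ ^ 3)
      (continuous_const.mul (continuous_norm_unvec.pow 3)) fun n ω => ?_
    simp only [Pi.sub_apply, Function.comp_apply, unvec_vec]
    set Khat := empCov (measurement t X ε) n ω
    have hsym : (Khat - K)ᵀ = Khat - K := by
      rw [transpose_sub, empCov_transpose, hK, KW_transpose hk]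
    have hn0 : (0 : ℝ) ≤ n := Nat.cast_nonneg n
    rw [limitForm_smul, Real.sq_sqrt hn0, ← mul_sub, abs_mul, abs_of_nonneg hn0, norm_smul,
      Real.norm_of_nonneg (Real.sqrt_nonneg _)]
    have hcube : (√(n : ℝ))⁻¹ * √(n : ℝ) ^ 3 = n := by
      rcases Nat.eq_zero_or_pos n with rfl | hn
      · simp
      · have : √(n : ℝ) ≠ 0 := (Real.sqrt_pos.2 (by exact_mod_cast hn)).ne'
        rw [pow_succ' _ 2, inv_mul_cancel_left₀ this, Real.sq_sqrt hn0]
    calc (n : ℝ) * |testStat q Khat - limitForm C G (Khat - K)|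
        ≤ n * (c * ‖Khat - K‖ ^ 3) := by gcongr; exact hexp Khat hsym
      _ = ((√(n : ℝ))⁻¹ * √(n : ℝ) ^ 3) * (c * ‖Khat - K‖ ^ 3) := by rw [hcube]
      _ = _ := by ring
  · exact ((measurable_testStat.comp (measurable_vec_empCov h n)).const_mul _).aemeasurable

end Limits

end OffDiagRank

theorem theorem2 (k : I → I → ℝ) (hk : OffDiagRank.IsCovarianceKernel k)
    (hcont : Continuous (Function.uncurry k)) (d : ℕ) (hd : 1 ≤ d) :
    ∃ Ldag : ℕ, d ≤ Ldag ∧ OffDiagRank.IsCriticalGridSize k d Ldag ∧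
      ∀ L : ℕ, Ldag < L → ∀ t : Fin L → I, OffDiagRank.RegularGrid t →
      ∀ q : ℕ, 1 ≤ q → q ≤ d →
      ∀ (Ω : Type*) [MeasurableSpace Ω] (P : Measure Ω) [IsProbabilityMeasure P]
        (v : Fin L → ℝ) (X : ℕ → I → Ω → ℝ) (ε : ℕ → Fin L → Ω → ℝ),
        OffDiagRank.NoisySample P k v X ε →
        -- the fluctuations of the empirical covariance have a centred Gaussian weak limit
        -- as soon as the measurements have finite fourth moments
        ((∀ j, MemLp (X 0 (t j)) 4 P) → (∀ j, MemLp (ε 0 j) 4 P) →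
          ∃ (Ω' : Type) (_ : MeasurableSpace Ω') (P' : Measure Ω') (_ : IsProbabilityMeasure P')
            (Z : Ω' → Matrix (Fin L) (Fin L) ℝ),
            HasGaussianLaw (fun ω' => vec (Z ω')) P' ∧ (∀ i j, ∫ ω', Z ω' i j ∂P' = 0) ∧
            OffDiagRank.IsFluctuationLimit P P' (OffDiagRank.measurement t X ε)
              (OffDiagRank.KW k t v) Z) ∧
        -- the null hypothesis
        (OffDiagRank.kernelRank k = q →
          ∀ (Ω' : Type*) [MeasurableSpace Ω'] (P' : Measure Ω') [IsProbabilityMeasure P']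
            (Z : Ω' → Matrix (Fin L) (Fin L) ℝ),
            OffDiagRank.IsFluctuationLimit P P' (OffDiagRank.measurement t X ε)
              (OffDiagRank.KW k t v) Z →
          ∀ C₀ : Matrix (Fin L) (Fin q) ℝ, OffDiagRank.KX k t = C₀ * C₀ᵀ →
            -- nonsingular Hessian
            (IsUnit (OffDiagRank.hessPsi (OffDiagRank.KW k t v) C₀) →
              TendstoInDistribution
                (fun (n : ℕ) ω => (n : ℝ) * OffDiagRank.testStat q
                  (OffDiagRank.empCov (OffDiagRank.measurement t X ε) n ω)) atTop
                (fun ω' => OffDiagRank.limitForm C₀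
                  (OffDiagRank.hessPsi (OffDiagRank.KW k t v) C₀)⁻¹ (Z ω'))
                (fun _ => P) P') ∧
            -- Hessian nonsingular up to rotations, with any generalized inverse `G`
            (OffDiagRank.HessNonsingularModRotations (OffDiagRank.KW k t v) C₀ →
              ∀ G : Matrix (Fin q × Fin L) (Fin q × Fin L) ℝ,
                OffDiagRank.hessPsi (OffDiagRank.KW k t v) C₀ * G *
                  OffDiagRank.hessPsi (OffDiagRank.KW k t v) C₀ =
                    OffDiagRank.hessPsi (OffDiagRank.KW k t v) C₀ →
              TendstoInDistribution
                (fun (n : ℕ) ω => (n : ℝ) * OffDiagRank.testStat q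
                  (OffDiagRank.empCov (OffDiagRank.measurement t X ε) n ω)) atTop
                (fun ω' => OffDiagRank.limitForm C₀ G (Z ω'))
                (fun _ => P) P')) ∧
        -- the alternative
        ((q : ℕ∞) < OffDiagRank.kernelRank k →
          ∀ᵐ ω ∂P, Tendsto (fun n : ℕ => (n : ℝ) * OffDiagRank.testStat q
            (OffDiagRank.empCov (OffDiagRank.measurement t X ε) n ω)) atTop atTop) := by
  obtain ⟨L₀, hdL, hmin⟩ := OffDiagRank.exists_grid_minors hcont d
  refine ⟨L₀, hdL, OffDiagRank.isCriticalGridSize_of_minors hcont hmin, ?_⟩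
  intro L hL t ht q _ hqd Ω _ P _ v X ε hs
  refine ⟨fun hX hε => OffDiagRank.exists_gaussian_fluctuationLimit hs hX hε,
    fun hrank Ω' _ P' _ Z hZ C₀ hC₀ => ?_, fun hrank => ?_⟩
  · have hminq := hmin L hL t ht q (by omega) hrank.ge
    refine ⟨fun hH => ?_, fun _ G hG => ?_⟩
    · refine OffDiagRank.tendstoInDistribution_testStat hk hs (by omega) hminq hZ hC₀ ?_
      rw [mul_nonsing_inv _ ((isUnit_iff_isUnit_det _).1 hH), Matrix.one_mul]
    · exact OffDiagRank.tendstoInDistribution_testStat hk hs (by omega) hminq hZ hC₀ hG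
  · have hq1 : ((q + 1 : ℕ) : ℕ∞) ≤ OffDiagRank.kernelRank k := by
      push_cast; exact Order.add_one_le_of_lt hrank
    exact OffDiagRank.tendsto_testStat_atTop hs
      (hmin L hL t ht (q + 1) (by omega) hq1 ⟨0, by omega⟩)
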